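/- Let $\lambda,\mu\in\mathbb{C}$ with $|\lambda|\ge|\mu|>1$ and $\lambda\neq\mu$, and let $\varphi\in\mathrm{Diff}^\infty([0,\infty))$ satisfy $\varphi(x)>x$ for $x>0$ and be tangent to the identity to infinite order at $0$. Let $\tilde R=(\mathbb{C}^2\times[0,\infty))\setminus\{(O,0)\}$, let $T(z_1,z_2,x)=(\lambda z_1,\mu z_2,\varphi(x))$ (the case $\tau=0$), and let $R=\tilde R/T^{\mathbb{Z}}$ be the quotient, with the foliation induced by the level sets of $x$ and its leafwise complex structure; its boundary is the Hopf surface $H=(\mathbb{C}^2\setminus\{O\})/\langle(z_1,z_2)\mapsto(\lambda z_1,\mu z_2)\rangle$. Let $\mathrm{Aut}(R,H)$ be the group of leafwise holomorphic smooth automorphisms of $R$ (foliation-preserving diffeomorphisms that are biholomorphic between leaves) which are the identity on $H$. Let $Z_\varphi$ be the centralizer of $\varphi$ in $\mathrm{Diff}^\infty([0,\infty))$. For $\nu\in\mathbb{C}$ let $\mathcal{Z}_{\varphi,\nu}$ be the vector space of $\beta\in C^\infty([0,\infty);\mathbb{C})$ with $\beta(\varphi(x))=\nu\beta(x)$ for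 all $x$. If $|\nu|>1$, every smooth solution $\beta$ of this equation on $(0,\infty)$ extends uniquely to an element of $\mathcal{Z}_{\varphi,\nu}$. Every $f\in\mathrm{Aut}(R,H)$ has a unique continuous lift $\tilde f:\tilde R\to\tilde R$ that is the identity on the boundary $\{x=0\}$. There is a surjective homomorphism $P:\mathrm{Aut}(R,H)\to Z_\varphi$ such that $P(f)(x)$ is the last coordinate of $\tilde f(z_1,z_2,x)$; thus, with $\mathcal{K}=\ker P$, $$1\to\mathcal{K}\to\mathrm{Aut}(R,H)\xrightarrow{\ P\ }Z_\varphi\to1$$ is exact. Moreover: 1) If $\lambda=\mu^p$ for some $p\ge2$, there is an exact sequence of groups $$0\to\mathcal{Z}_{\varphi,\mu^p}\times\mathcal{Z}_{\varphi,\mu^{p-1}}\times\cdots\times\mathcal{Z}_{\varphi,\mu}\to\mathcal{K}\to\mathcal{Z}_{\varphi,\mu}\to0.$$ 2) If $\lambda\neq\mu^m$ for all $m\ge1$, there is an exact sequence of groups $$0\to\mathcal{Z}_{\varphi,\lambda}\times\mathcal{Z}_{\varphi,\lambda\mu^{-1}}\times\cdots\times\mathcal{Z}_{\varphi,\lambda\mu^{-p}}\to\mathcal{K}\to\mathcal{Z}_{\varphi,\mu}\to0,\qquad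 p=\left[\frac{\log|\lambda|}{\log|\mu|}\right],$$ where $[\,\cdot\,]$ is the greatest integer function. In both cases the first map sends $(\beta_0,\beta_1,\dots)$ to the automorphism whose lift is $(z_1,z_2,x)\mapsto(z_1+\sum_j\beta_j(x)z_2^j,\,z_2,\,x)$, and the second sends $f$ to the function $\beta_2$ for which the second coordinate of $\tilde f(z_1,z_2,x)$ is $z_2+\beta_2(x)$. -/

import Mathlib

open scoped ContDiff NNReal

noncomputable section

/-- Smoothness, up to the boundary point `0`, of a function on the closed half line `[0, ∞)`. -/
def SmoothOnHalfLine {E : Type*} [NormedAddCommGroup E] [NormedSpace ℝ E] (f : ℝ≥0 → E) : Prop :=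
  ContDiffOn ℝ ∞ (fun x : ℝ => f x.toNNReal) (Set.Ici 0)

theorem SmoothOnHalfLine.comp_half {E : Type*} [NormedAddCommGroup E] [NormedSpace ℝ E]
    {f : ℝ≥0 → E} {g : ℝ≥0 → ℝ≥0} (hf : SmoothOnHalfLine f)
    (hg : SmoothOnHalfLine (fun x => (g x : ℝ))) : SmoothOnHalfLine (fun x => f (g x)) := by
  have h := ContDiffOn.comp (g := fun x : ℝ => f x.toNNReal)
    (f := fun x : ℝ => ((g x.toNNReal : ℝ≥0) : ℝ)) hf hg (fun x _ => NNReal.coe_nonneg _)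
  refine h.congr ?_
  intro x _
  simp

/-- The group `Diff^∞([0, ∞))` of smooth diffeomorphisms of the closed half line; the group law is
composition. -/
def DiffHalfLine : Subgroup (Equiv.Perm ℝ≥0) where
  carrier := {η | SmoothOnHalfLine (fun x => (η x : ℝ)) ∧ SmoothOnHalfLine (fun x => (η⁻¹ x : ℝ))}
  mul_mem' := by
    rintro a b ⟨ha, ha'⟩ ⟨hb, hb'⟩
    refine ⟨ha.comp_half hb, ?_⟩
    rw [mul_inv_rev]
    exact hb'.comp_half ha'
  one_mem' := by
    have h : SmoothOnHalfLine (fun x => (x : ℝ)) :=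
      contDiffOn_id.congr (fun x hx => Real.coe_toNNReal x hx)
    exact ⟨h, h⟩
  inv_mem' := by
    rintro a ⟨ha, ha'⟩
    exact ⟨ha', by simpa only [inv_inv] using ha⟩

/-- The centralizer `Z_φ` of `φ` in `Diff^∞([0, ∞))`. -/
def diffCentralizer (φ : DiffHalfLine) : Subgroup DiffHalfLine :=
  Subgroup.centralizer {φ}

/-- `φ` is tangent to the identity to infinite order at `0`. -/
def InfinitelyTangentToId (φ : DiffHalfLine) : Prop :=
  ∀ n : ℕ, iteratedDerivWithin n (fun x : ℝ => (φ.1 x.toNNReal : ℝ) - x) (Set.Ici 0) 0 = 0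

/-- The space `𝒵_{φ,ν}` of smooth functions `β : [0, ∞) → ℂ` with `β (φ x) = ν β x`. -/
def solutionSpace (φ : DiffHalfLine) (ν : ℂ) : Submodule ℂ (ℝ≥0 → ℂ) where
  carrier := {β | SmoothOnHalfLine β ∧ ∀ x, β (φ.1 x) = ν * β x}
  add_mem' := by
    rintro a b ⟨ha, ha'⟩ ⟨hb, hb'⟩
    exact ⟨ContDiffOn.add ha hb, fun x => by simp [ha', hb', mul_add]⟩
  zero_mem' := ⟨contDiffOn_const, fun x => by simp⟩
  smul_mem' := by
    rintro c a ⟨ha, ha'⟩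
    refine ⟨ContDiffOn.const_smul c ha, fun x => ?_⟩
    simp only [Pi.smul_apply, ha', smul_eq_mul]
    ring

theorem DiffHalfLine.apply_zero (φ : DiffHalfLine) : φ.1 0 = 0 := by
  have hc : Continuous φ.1 := by
    have h2 : Continuous (fun x : ℝ≥0 => ((φ.1 (x : ℝ).toNNReal : ℝ≥0) : ℝ)) :=
      φ.2.1.continuousOn.comp_continuous NNReal.continuous_coe (fun x => x.2)
    simp only [Real.toNNReal_coe] at h2
    exact continuous_induced_rng.2 h2
  obtain ⟨a, ha⟩ := φ.1.surjective 0
  rcases hc.strictMono_of_inj φ.1.injective with h | h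
  · have h0 : φ.1 0 ≤ φ.1 a := h.monotone bot_le
    exact le_antisymm (ha ▸ h0) bot_le
  · have h1 : φ.1 (a + 1) < φ.1 a := h (lt_add_of_pos_right a one_pos)
    rw [ha] at h1
    exact absurd h1 not_lt_zero

/-- The manifold with boundary `R̃ = ℂ² × [0, ∞) ∖ {(O, 0)}`, as a subset of `ℂ × ℂ × ℝ`. Its leaves
are the level sets of the last coordinate. -/
def reebCover : Set (ℂ × ℂ × ℝ) := {q | 0 ≤ q.2.2 ∧ q ≠ 0}

/-- The last coordinate of a point of `R̃`. -/
def height (q : reebCover) : ℝ≥0 := ⟨q.1.2.2, q.2.1⟩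

/-- The map `(z₁, z₂, x) ↦ (a z₁, b z₂, ψ x)` of `R̃` into itself, for nonzero `a`, `b`. -/
def diagMap (a b : ℂˣ) (ψ : DiffHalfLine) (q : reebCover) : reebCover :=
  ⟨(a * q.1.1, b * q.1.2.1, (ψ.1 (height q) : ℝ)), NNReal.coe_nonneg _, by
    intro h
    simp only [Prod.mk_eq_zero, Units.mul_right_eq_zero, NNReal.coe_eq_zero] at h
    obtain ⟨h1, h2, h3⟩ := h
    have h4 : height q = 0 := ψ.1.injective (h3.trans (DiffHalfLine.apply_zero ψ).symm)
    exact q.2.2 (Prod.ext h1 (Prod.ext h2 (congrArg NNReal.toReal h4)))⟩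

theorem diagMap_diagMap (a b a' b' : ℂˣ) (ψ ψ' : DiffHalfLine) (q : reebCover) :
    diagMap a b ψ (diagMap a' b' ψ' q) = diagMap (a * a') (b * b') (ψ * ψ') q := by
  apply Subtype.ext
  simp only [diagMap, height, Units.val_mul, mul_assoc]
  rfl

theorem diagMap_one (q : reebCover) : diagMap 1 1 1 q = q := by
  apply Subtype.ext
  simp only [diagMap, Units.val_one, one_mul]
  rfl

/-- The transformation `T (z₁, z₂, x) = (λ z₁, μ z₂, φ x)` of `R̃`. -/
def coverMap (lam mu : ℂˣ) (φ : DiffHalfLine) : Equiv.Perm reebCover where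
  toFun := diagMap lam mu φ
  invFun := diagMap lam⁻¹ mu⁻¹ φ⁻¹
  left_inv q := by
    rw [diagMap_diagMap, inv_mul_cancel, inv_mul_cancel, inv_mul_cancel, diagMap_one]
  right_inv q := by
    rw [diagMap_diagMap, mul_inv_cancel, mul_inv_cancel, mul_inv_cancel, diagMap_one]

/-- The Reeb component `R = R̃ / T^ℤ`. -/
abbrev Reeb (lam mu : ℂˣ) (φ : DiffHalfLine) : Type :=
  MulAction.orbitRel.Quotient (Subgroup.zpowers (coverMap lam mu φ)) reebCover

/-- The quotient map `R̃ → R`. -/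
def reebProj (lam mu : ℂˣ) (φ : DiffHalfLine) (q : reebCover) : Reeb lam mu φ :=
  Quotient.mk _ q

/-- The boundary leaf `H = W / G^ℤ` of `R`, with `W = ℂ² ∖ {O}` and `G (z₁, z₂) = (λ z₁, μ z₂)`:
the image of the boundary `W × {0}` of `R̃`. -/
def reebBoundary (lam mu : ℂˣ) (φ : DiffHalfLine) : Set (Reeb lam mu φ) :=
  reebProj lam mu φ '' {q | height q = 0}

/-- A self-map of `R` is smooth, preserves the foliation and is holomorphic along the leaves.

The structure of `R` is the one for which the covering map `R̃ → R` is a local isomorphism: its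
foliated charts, with coordinates `(z₁, z₂, x)`, are the local inverses of the covering map. So
the condition is that near every point `f` is represented in these coordinates by a map `F` which
is smooth (up to the boundary), whose last component depends on `x` only (it sends plaques into
plaques), and whose first two components are holomorphic in `(z₁, z₂)` for every fixed `x`. -/
def IsLeafwiseHolomorphic (lam mu : ℂˣ) (φ : DiffHalfLine)
    (f : Reeb lam mu φ → Reeb lam mu φ) : Prop :=
  ∀ q : reebCover, ∃ (U : Set (ℂ × ℂ × ℝ)) (F : ℂ × ℂ × ℝ → ℂ × ℂ × ℝ),
    IsOpen U ∧ q.1 ∈ U ∧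
    (∀ r : reebCover, r.1 ∈ U →
      ∃ s : reebCover, s.1 = F r.1 ∧ reebProj lam mu φ s = f (reebProj lam mu φ r)) ∧
    ContDiffOn ℝ ∞ F (U ∩ reebCover) ∧
    (∀ r ∈ U ∩ reebCover, ∀ r' ∈ U ∩ reebCover, r.2.2 = r'.2.2 → (F r).2.2 = (F r').2.2) ∧
    ∀ x : ℝ, DifferentiableOn ℂ
      (fun z : ℂ × ℂ => ((F (z.1, z.2, x)).1, (F (z.1, z.2, x)).2.1))
      {z | (z.1, z.2, x) ∈ U ∩ reebCover}

theorem IsLeafwiseHolomorphic.comp_self {lam mu : ℂˣ} {φ : DiffHalfLine}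
    {f g : Reeb lam mu φ → Reeb lam mu φ} (hf : IsLeafwiseHolomorphic lam mu φ f)
    (hg : IsLeafwiseHolomorphic lam mu φ g) :
    IsLeafwiseHolomorphic lam mu φ (fun y => f (g y)) := by
  intro q
  obtain ⟨U, G, hU, hq, hG, hGs, hGp, hGh⟩ := hg q
  obtain ⟨s, hs, -⟩ := hG q hq
  obtain ⟨V, F, hV, hsV, hF, hFs, hFp, hFh⟩ := hf s
  obtain ⟨O, hO, hOeq⟩ := (continuousOn_iff'.1 hGs.continuousOn) V hV
  have key : ∀ r ∈ (U ∩ O) ∩ reebCover, r ∈ U ∩ reebCover ∧ G r ∈ V ∩ reebCover := by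
    rintro r ⟨⟨h1, h2⟩, h3⟩
    obtain ⟨t, ht, -⟩ := hG ⟨r, h3⟩ h1
    have h4 : r ∈ G ⁻¹' V ∩ (U ∩ reebCover) := hOeq ▸ ⟨h2, h1, h3⟩
    exact ⟨⟨h1, h3⟩, h4.1, ht ▸ t.2⟩
  refine ⟨U ∩ O, fun r => F (G r), hU.inter hO, ⟨hq, ?_⟩, ?_, ?_, ?_, ?_⟩
  · have h : q.1 ∈ G ⁻¹' V ∩ (U ∩ reebCover) := ⟨(hs ▸ hsV : G q.1 ∈ V), hq, q.2⟩
    exact (hOeq ▸ h).1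
  · intro r hr
    obtain ⟨t, ht, ht'⟩ := hG r hr.1
    obtain ⟨u, hu, hu'⟩ := hF t (ht ▸ (key r.1 ⟨hr, r.2⟩).2.1)
    exact ⟨u, by rw [hu, ht], by rw [hu', ht']⟩
  · exact hFs.comp (hGs.mono fun r hr => (key r hr).1) fun r hr => (key r hr).2
  · intro r hr r' hr' h
    exact hFp _ (key r hr).2 _ (key r' hr').2 (hGp _ (key r hr).1 _ (key r' hr').1 h)
  · intro x
    by_cases hne : ∃ z₀ : ℂ × ℂ, (z₀.1, z₀.2, x) ∈ (U ∩ O) ∩ reebCover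
    · obtain ⟨z₀, hz₀⟩ := hne
      set c := (G (z₀.1, z₀.2, x)).2.2 with hc
      have hG3 : ∀ z : ℂ × ℂ, (z.1, z.2, x) ∈ (U ∩ O) ∩ reebCover →
          G (z.1, z.2, x) = ((G (z.1, z.2, x)).1, (G (z.1, z.2, x)).2.1, c) := fun z hz =>
        Prod.ext rfl (Prod.ext rfl (hGp _ (key _ hz).1 _ (key _ hz₀).1 rfl))
      refine ((hFh c).comp ((hGh x).mono fun z hz => (key _ hz).1) ?_).congr ?_
      · intro z hz
        have h := (key _ hz).2
        rw [hG3 z hz] at h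
        exact h
      · intro z hz
        have h := hG3 z hz
        simp only [Function.comp]
        rw [← h]
    · intro z hz
      exact absurd ⟨z, hz⟩ hne

/-- The group `Aut R` of leafwise holomorphic smooth automorphisms of `R`; the group law is
composition. -/
def autReeb (lam mu : ℂˣ) (φ : DiffHalfLine) : Subgroup (Equiv.Perm (Reeb lam mu φ)) where
  carrier := {f | IsLeafwiseHolomorphic lam mu φ (fun y => f y) ∧
    IsLeafwiseHolomorphic lam mu φ (fun y => f⁻¹ y)}
  mul_mem' := by
    rintro a b ⟨ha, ha'⟩ ⟨hb, hb'⟩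
    refine ⟨ha.comp_self hb, ?_⟩
    rw [mul_inv_rev]
    exact hb'.comp_self ha'
  one_mem' := by
    have h : IsLeafwiseHolomorphic lam mu φ (fun y => y) := fun q =>
      ⟨Set.univ, fun r => r, isOpen_univ, trivial, fun r _ => ⟨r, rfl, rfl⟩, contDiffOn_id,
        fun _ _ _ _ h => h, fun _ => differentiableOn_id⟩
    exact ⟨h, h⟩
  inv_mem' := by
    rintro a ⟨ha, ha'⟩
    exact ⟨ha', by simpa only [inv_inv] using ha⟩

/-- The group `Aut(R, H)`: the automorphisms of `R` that restrict to the identity on `H`, i.e. the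
kernel of the restriction map `Aut R → Aut H`. -/
def autReebRel (lam mu : ℂˣ) (φ : DiffHalfLine) : Subgroup (Equiv.Perm (Reeb lam mu φ)) :=
  autReeb lam mu φ ⊓ fixingSubgroup (Equiv.Perm (Reeb lam mu φ)) (reebBoundary lam mu φ)

/-- `g` is a continuous lift to `R̃` of the self-map `f` of `R`, and is the identity on the boundary
of `R̃`. -/
def IsRelLift (lam mu : ℂˣ) (φ : DiffHalfLine) (f : Reeb lam mu φ → Reeb lam mu φ)
    (g : reebCover → reebCover) : Prop :=
  Continuous g ∧ (∀ q, reebProj lam mu φ (g q) = f (reebProj lam mu φ q)) ∧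
    ∀ q, height q = 0 → g q = q

end

/-! ### The covering of the Reeb component and its leaves -/

noncomputable section

open Topology Filter

/-! Along every orbit of `T` the quantity `|z₁| + |z₂| + x` increases strictly, so `T` acts properly
discontinuously on `R̃` and `R̃ → R` is a covering (`IsExpanding.isQuotientCoveringMap`). As `R̃` is
contractible, an automorphism fixing `H` pointwise has exactly one lift `g` that is the identity on
the boundary, and `g` commutes with `T`, because `T⁻¹ g T` is another such lift. The leaves are
connected, so the last coordinate of `g` depends on `x` alone; this gives `P`, and for `ψ ∈ Z_φ` the
map `id × ψ` descends to `R`, which makes `P` surjective.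

If `g` preserves heights, then `U = g₁ - z₁` and `U = g₂ - z₂` vanish on the boundary, are entire on
interior leaves, and satisfy `U ∘ T = c U` with `c = λ` and `c = μ` respectively. Near the boundary
`U` is at most `ε` on the unit bidisc: by continuity on a compact set avoiding the origin, then by
the maximum principle. Transport by `T ^ n` turns this into `|U| ≤ ε |c| ^ n` for `|z₁| ≤ |λ| ^ n`,
`|z₂| ≤ |μ| ^ n`. Cauchy's estimates then remove all dependence on `z₁` and all powers `z₂ ^ k` with
`|c| ≤ |μ| ^ k` (`IsEquivariantFun.exists_eq_sum`). Since `ε` is arbitrary, the borderline case of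
equality is removed too; this is why the resonance `λ = μ ^ p` stops at degree `p - 1` and why `g₂ -
z₂` depends on `x` only. The coefficients are smooth by interpolation, and equivariance puts the
coefficient of `z₂ ^ j` into `𝒵_{φ,ν}` with `ν = c μ ^ (-j)`.

Conversely, triangular maps with such coefficients commute with `T`, and the coefficients vanish at
`0` since `ν ≠ 1`, so these maps descend to elements of the kernel (`exists_relLift_eq_shear`).
Reading off the second coordinate is a homomorphism whose kernel consists of the shears in `z₁`.

For the extension statement, `β ∘ φ = ν β` with `|ν| > 1` forces `β → 0` at `0`. Differentiation
yields an equation `g ∘ φ = a g + h` of the same type for `β'`, with unchanged `a(0)` because `φ'(0)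
= 1`. By induction all derivatives tend to `0`, and extension by zero is smooth
(`flatAtZero_of_cocycle`, `contDiffOn_extendZero`). -/

theorem DiffHalfLine.continuous (φ : DiffHalfLine) : Continuous φ.1 := by
  have h : Continuous (fun x : ℝ≥0 => ((φ.1 (x : ℝ).toNNReal : ℝ≥0) : ℝ)) :=
    φ.2.1.continuousOn.comp_continuous NNReal.continuous_coe (fun x => x.2)
  simp only [Real.toNNReal_coe] at h
  exact continuous_induced_rng.2 h

theorem DiffHalfLine.pos_of_pos (φ : DiffHalfLine) {x : ℝ≥0} (hx : 0 < x) : 0 < φ.1 x := by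
  refine pos_iff_ne_zero.2 fun h => hx.ne' (φ.1.injective ?_)
  rw [h, DiffHalfLine.apply_zero]

/-- The hypotheses on `λ`, `μ` and `φ` under which `R̃ / T^ℤ` is a Reeb component. -/
structure IsExpanding (lam mu : ℂˣ) (φ : DiffHalfLine) : Prop where
  one_lt_mu : 1 < ‖(mu : ℂ)‖
  mu_le_lam : ‖(mu : ℂ)‖ ≤ ‖(lam : ℂ)‖
  lt_apply : ∀ x : ℝ≥0, 0 < x → x < φ.1 x

section Cover

variable {lam mu : ℂˣ} {φ : DiffHalfLine}

theorem IsExpanding.one_lt_lam (h : IsExpanding lam mu φ) : 1 < ‖(lam : ℂ)‖ :=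
  h.one_lt_mu.trans_le h.mu_le_lam

theorem continuous_height : Continuous height :=
  (continuous_snd.comp (continuous_snd.comp continuous_subtype_val)).subtype_mk _

theorem continuous_diagMap (a b : ℂˣ) (ψ : DiffHalfLine) : Continuous (diagMap a b ψ) := by
  refine Continuous.subtype_mk ?_ _
  have h := (DiffHalfLine.continuous ψ).comp continuous_height
  have h1 : Continuous fun q : reebCover => q.1.1 := continuous_fst.comp continuous_subtype_val
  have h2 : Continuous fun q : reebCover => q.1.2.1 :=
    continuous_fst.comp (continuous_snd.comp continuous_subtype_val)
  exact (continuous_const.mul h1).prodMk ((continuous_const.mul h2).prodMk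
    (NNReal.continuous_coe.comp h))

/-- The diagonal maps of `R̃`, as a homomorphism into its group of permutations. -/
def diagHom : ℂˣ × ℂˣ × DiffHalfLine →* Equiv.Perm reebCover where
  toFun t := coverMap t.1 t.2.1 t.2.2
  map_one' := Equiv.ext diagMap_one
  map_mul' _ _ := Equiv.ext fun q => (diagMap_diagMap _ _ _ _ _ _ q).symm

theorem coverMap_zpow (n : ℤ) :
    coverMap lam mu φ ^ n = coverMap (lam ^ n) (mu ^ n) (φ ^ n) :=
  (map_zpow diagHom (lam, mu, φ) n).symm

theorem continuous_coverMap_zpow (n : ℤ) : Continuous (coverMap lam mu φ ^ n : Equiv.Perm _) := by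
  rw [coverMap_zpow]
  exact continuous_diagMap _ _ _

theorem height_coverMap (a b : ℂˣ) (ψ : DiffHalfLine) (q : reebCover) :
    height (coverMap a b ψ q) = ψ.1 (height q) := rfl

theorem reebProj_eq_iff {q r : reebCover} :
    reebProj lam mu φ q = reebProj lam mu φ r ↔
      ∃ n : ℤ, q = (coverMap lam mu φ ^ n : Equiv.Perm _) r := by
  unfold reebProj
  rw [Quotient.eq, MulAction.orbitRel_apply, MulAction.mem_orbit_iff]
  constructor
  · rintro ⟨⟨_, n, rfl⟩, h⟩
    exact ⟨n, h.symm⟩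
  · rintro ⟨n, h⟩
    exact ⟨⟨_, n, rfl⟩, h.symm⟩

theorem reebProj_zpow (n : ℤ) (q : reebCover) :
    reebProj lam mu φ ((coverMap lam mu φ ^ n : Equiv.Perm _) q) = reebProj lam mu φ q :=
  reebProj_eq_iff.2 ⟨n, rfl⟩

theorem reebProj_coverMap (q : reebCover) :
    reebProj lam mu φ (coverMap lam mu φ q) = reebProj lam mu φ q := by
  simpa using reebProj_zpow (lam := lam) (mu := mu) (φ := φ) 1 q

/-- A continuous function on `R̃` which increases along the orbits of `T`. -/
def coverSize (q : reebCover) : ℝ := ‖q.1.1‖ + ‖q.1.2.1‖ + q.1.2.2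

theorem continuous_coverSize : Continuous coverSize := by
  have h1 : Continuous fun q : reebCover => q.1.1 := continuous_fst.comp continuous_subtype_val
  have h2 : Continuous fun q : reebCover => q.1.2.1 :=
    continuous_fst.comp (continuous_snd.comp continuous_subtype_val)
  have h3 : Continuous fun q : reebCover => q.1.2.2 :=
    continuous_snd.comp (continuous_snd.comp continuous_subtype_val)
  exact (h1.norm.add h2.norm).add h3

/-- None of the three terms decreases, and each nonzero one grows strictly. At least one is nonzero
because the point `(O, 0)` has been removed. -/
theorem IsExpanding.coverSize_lt (h : IsExpanding lam mu φ) (q : reebCover) :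
    coverSize q < coverSize (coverMap lam mu φ q) := by
  have e : coverSize (coverMap lam mu φ q) =
      ‖(lam : ℂ)‖ * ‖q.1.1‖ + ‖(mu : ℂ)‖ * ‖q.1.2.1‖ + φ.1 (height q) := by
    simp [coverSize, coverMap, diagMap]
  have e' : coverSize q = ‖q.1.1‖ + ‖q.1.2.1‖ + height q := rfl
  have h1 := h.one_lt_lam
  have h2 := h.one_lt_mu
  have h0 : (height q : ℝ) ≤ φ.1 (height q) := by
    rcases (height q).2.eq_or_lt with h0 | h0
    · have : height q = 0 := NNReal.eq h0.symm
      rw [this, DiffHalfLine.apply_zero]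
    · exact_mod_cast (h.lt_apply _ h0).le
  have n1 := norm_nonneg q.1.1
  have n2 := norm_nonneg q.1.2.1
  rw [e, e']
  by_cases z1 : q.1.1 = 0
  · by_cases z2 : q.1.2.1 = 0
    · have h3 : 0 < height q := by
        refine pos_iff_ne_zero.2 fun h0 => q.2.2 (Prod.ext z1 (Prod.ext z2 ?_))
        exact congrArg NNReal.toReal h0
      have := NNReal.coe_lt_coe.2 (h.lt_apply _ h3)
      nlinarith
    · have := norm_pos_iff.2 z2
      nlinarith
  · have := norm_pos_iff.2 z1
    nlinarith

theorem IsExpanding.coverSize_le_pow (h : IsExpanding lam mu φ) (n : ℕ) (q : reebCover) :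
    coverSize q ≤ coverSize ((coverMap lam mu φ ^ n : Equiv.Perm _) q) := by
  induction n with
  | zero => simp
  | succ n ih => exact ih.trans (by rw [pow_succ']; exact (h.coverSize_lt _).le)

/-- Every point of `R̃` has a neighbourhood which is disjoint from its translates. -/
theorem IsExpanding.exists_nhds_disjoint (h : IsExpanding lam mu φ) (q : reebCover) :
    ∃ U ∈ 𝓝 q, ∀ n : ℤ, ∀ r ∈ U, (coverMap lam mu φ ^ n : Equiv.Perm _) r ∈ U → n = 0 := by
  -- The level `c` separates `q` from `T q`. The neighbourhood consists of the points whose size is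
  -- below `c` and passes `c` after one application of `T`; all later iterates stay above `c`, so
  -- none returns. Negative powers reduce to this by exchanging the two points.
  obtain ⟨c, hc, hc'⟩ := exists_between (h.coverSize_lt q)
  have hT : Continuous (coverMap lam mu φ) := continuous_diagMap _ _ _
  refine ⟨{r | coverSize r < c ∧ c < coverSize (coverMap lam mu φ r)}, ?_, ?_⟩
  · exact ((isOpen_lt continuous_coverSize continuous_const).inter
      (isOpen_lt continuous_const (continuous_coverSize.comp hT))).mem_nhds ⟨hc, hc'⟩
  · have key : ∀ (n : ℕ) (r : reebCover), c < coverSize (coverMap lam mu φ r) →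
        c < coverSize ((coverMap lam mu φ ^ (n + 1) : Equiv.Perm _) r) := fun n r hr =>
      hr.trans_le (by rw [pow_succ]; exact h.coverSize_le_pow n _)
    rintro n r ⟨h1, h2⟩ ⟨h3, h4⟩
    rcases lt_trichotomy n 0 with hn | hn | hn
    · obtain ⟨m, rfl⟩ : ∃ m : ℕ, n = -((m + 1 : ℕ) : ℤ) :=
        ⟨(-n - 1).toNat, by omega⟩
      have := key m _ h4
      rw [zpow_neg, zpow_natCast, Equiv.Perm.coe_inv, Equiv.apply_symm_apply] at this
      exact absurd this h1.not_gt
    · exact hn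
    · obtain ⟨m, rfl⟩ : ∃ m : ℕ, n = ((m + 1 : ℕ) : ℤ) := ⟨(n - 1).toNat, by omega⟩
      have := key m _ h2
      rw [zpow_natCast] at h3
      exact absurd this h3.not_gt

theorem IsExpanding.isQuotientCoveringMap (h : IsExpanding lam mu φ) :
    IsQuotientCoveringMap (reebProj lam mu φ) (Subgroup.zpowers (coverMap lam mu φ)) where
  toIsQuotientMap := isQuotientMap_quotient_mk'
  continuous_const_smul := by
    rintro ⟨_, n, rfl⟩
    exact continuous_coverMap_zpow n
  apply_eq_iff_mem_orbit := Quotient.eq''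
  disjoint q := by
    obtain ⟨U, hU, hd⟩ := h.exists_nhds_disjoint q
    refine ⟨U, hU, ?_⟩
    rintro ⟨_, n, rfl⟩ ⟨_, ⟨r, hr, rfl⟩, hr'⟩
    obtain rfl := hd n r hr hr'
    simp

theorem IsExpanding.isCoveringMap (h : IsExpanding lam mu φ) :
    IsCoveringMap (reebProj lam mu φ) :=
  h.isQuotientCoveringMap.isCoveringMap

/-- A segment from `(0, 0, 1)` to a point of `R̃` has positive height except possibly at its
endpoint, so it misses the origin. Contractibility supplies the simple connectedness needed to lift
maps. -/
instance : ContractibleSpace reebCover := by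
  refine StarConvex.contractibleSpace (x := ((0, 0, 1) : ℂ × ℂ × ℝ)) ?_ ⟨(0, 0, 1), ?_⟩
  · rintro ⟨z, w, x⟩ ⟨hx, hne⟩ a b ha hb hab
    simp only at hx
    rcases ha.eq_or_lt with rfl | ha
    · obtain rfl : b = 1 := by linarith
      simpa using ⟨hx, hne⟩
    · have : 0 < a + b * x := add_pos_of_pos_of_nonneg ha (mul_nonneg hb hx)
      refine ⟨by simpa using this.le, fun h0 => this.ne' ?_⟩
      simpa using congrArg (fun q : ℂ × ℂ × ℝ => q.2.2) h0
  · simp [reebCover]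

instance : LocallyPathConnectedSpace reebCover := by
  have hconv : Convex ℝ {q : ℂ × ℂ × ℝ | 0 ≤ q.2.2} := by
    intro q hq r hr a b ha hb _
    exact add_nonneg (mul_nonneg ha hq) (mul_nonneg hb hr)
  have := hconv.locallyPathConnectedSpace
  have hsub : reebCover ⊆ {q : ℂ × ℂ × ℝ | 0 ≤ q.2.2} := fun q hq => hq.1
  refine IsOpenEmbedding.locallyPathConnectedSpace (e := Set.inclusion hsub)
    ⟨IsEmbedding.inclusion hsub, ?_⟩
  rw [Set.range_inclusion]
  have : {x : {q : ℂ × ℂ × ℝ | 0 ≤ q.2.2} | (x : ℂ × ℂ × ℝ) ∈ reebCover} =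
      Subtype.val ⁻¹' ({0}ᶜ : Set (ℂ × ℂ × ℝ)) := by
    ext x
    exact ⟨fun hx => hx.2, fun hx => ⟨x.2, hx⟩⟩
  rw [this]
  exact isOpen_compl_singleton.preimage continuous_subtype_val

/-- The slice of `R̃` at height `x`, as a subset of `ℂ²`. -/
def coverSlice (x : ℝ) : Set (ℂ × ℂ) := {z | (z.1, z.2, x) ∈ reebCover}

theorem coverSlice_of_pos {x : ℝ} (hx : 0 < x) : coverSlice x = Set.univ :=
  Set.eq_univ_of_forall fun z => ⟨hx.le, fun h => hx.ne' (by
    simpa using congrArg (fun q : ℂ × ℂ × ℝ => q.2.2) h)⟩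

theorem coverSlice_zero : coverSlice 0 = {0}ᶜ := by
  ext z
  simp [coverSlice, reebCover, Prod.ext_iff]

/-- Only the boundary slice is not obvious: it is `ℂ²` minus a point, connected since the real
dimension exceeds one. -/
theorem isPreconnected_coverSlice (x : ℝ) : IsPreconnected (coverSlice x) := by
  rcases lt_trichotomy x 0 with hx | rfl | hx
  · have : coverSlice x = ∅ := Set.eq_empty_of_forall_notMem fun z hz => hx.not_ge hz.1
    rw [this]
    exact isPreconnected_empty
  · rw [coverSlice_zero]
    refine (isConnected_compl_singleton_of_one_lt_rank ?_ 0).isPreconnected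
    simp [Complex.rank_real_complex]
    norm_num
  · rw [coverSlice_of_pos hx]
    exact isPreconnected_univ

theorem isPreconnected_height_fiber (x : ℝ≥0) : IsPreconnected {q | height q = x} := by
  have := isPreconnected_iff_preconnectedSpace.1 (isPreconnected_coverSlice x)
  let i : coverSlice x → reebCover := fun z => ⟨(z.1.1, z.1.2, x), z.2⟩
  have hi : Continuous i := by
    refine Continuous.subtype_mk ?_ _
    exact (continuous_fst.comp continuous_subtype_val).prodMk
      ((continuous_snd.comp continuous_subtype_val).prodMk continuous_const)
  have e : {q | height q = x} = Set.range i := by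
    refine Set.Subset.antisymm ?_ ?_
    · rintro ⟨⟨z, w, x'⟩, hs'⟩ hs
      have hx : x' = x := congrArg NNReal.toReal hs
      subst hx
      exact ⟨⟨(z, w), hs'⟩, rfl⟩
    · rintro _ ⟨z, rfl⟩
      exact NNReal.eq rfl
  rw [e]
  exact isPreconnected_range hi

/-- A function on `R̃` that is locally constant along the leaves is a function of the height. -/
theorem eq_of_height_eq {α : Type*} (f : reebCover → α)
    (hf : ∀ q, ∀ᶠ r in 𝓝 q, height r = height q → f r = f q) {q r : reebCover}
    (hqr : height q = height r) : f q = f r := by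
  have := isPreconnected_iff_preconnectedSpace.1 (isPreconnected_height_fiber (height q))
  have hlc : IsLocallyConstant fun s : {s | height s = height q} => f s := by
    rw [IsLocallyConstant.iff_eventually_eq]
    intro s
    filter_upwards [continuous_subtype_val.continuousAt.eventually (hf s)] with t ht
    exact ht (t.2.trans s.2.symm)
  exact hlc.apply_eq_of_preconnectedSpace ⟨q, rfl⟩ ⟨r, hqr.symm⟩

end Cover
end

/-! ### Regularity of lifts -/

noncomputable section

open Topology Filter

section Lift

variable {lam mu : ℂˣ} {φ : DiffHalfLine}

open Classical in
/-- The extension by zero of a self-map of `R̃` to a self-map of `ℂ × ℂ × ℝ`. -/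
def ambientExt (g : reebCover → reebCover) (q : ℂ × ℂ × ℝ) : ℂ × ℂ × ℝ :=
  if h : q ∈ reebCover then (g ⟨q, h⟩).1 else 0

theorem ambientExt_apply (g : reebCover → reebCover) (q : reebCover) :
    ambientExt g q.1 = (g q).1 := dif_pos q.2

theorem ambientExt_of_mem (g : reebCover → reebCover) {q : ℂ × ℂ × ℝ} (h : q ∈ reebCover) :
    ambientExt g q = (g ⟨q, h⟩).1 := dif_pos h

/-- A self-map of `R̃` is smooth, preserves the foliation and is holomorphic along the leaves. -/
structure IsLeafwiseMap (g : reebCover → reebCover) : Prop where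
  contDiffOn : ContDiffOn ℝ ∞ (ambientExt g) reebCover
  height_eq : ∀ q r, height q = height r → height (g q) = height (g r)
  differentiableOn : ∀ x : ℝ, DifferentiableOn ℂ
    (fun z : ℂ × ℂ => ((ambientExt g (z.1, z.2, x)).1, (ambientExt g (z.1, z.2, x)).2.1))
    (coverSlice x)

/-- Near every point, a leafwise holomorphic self-map of `R` has a lift to `R̃`. -/
theorem IsLeafwiseHolomorphic.exists_local_lift {f : Reeb lam mu φ → Reeb lam mu φ}
    (hf : IsLeafwiseHolomorphic lam mu φ f) (q : reebCover) :
    ∃ (U : Set (ℂ × ℂ × ℝ)) (G : reebCover → reebCover),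
      IsOpen U ∧ q.1 ∈ U ∧ ContinuousAt G q ∧
      (∀ r : reebCover, r.1 ∈ U → reebProj lam mu φ (G r) = f (reebProj lam mu φ r)) ∧
      ContDiffOn ℝ ∞ (ambientExt G) (U ∩ reebCover) ∧
      (∀ r r' : reebCover, r.1 ∈ U → r'.1 ∈ U → height r = height r' →
        height (G r) = height (G r')) ∧
      ∀ x : ℝ, DifferentiableOn ℂ
        (fun z : ℂ × ℂ => ((ambientExt G (z.1, z.2, x)).1, (ambientExt G (z.1, z.2, x)).2.1))
        {z | (z.1, z.2, x) ∈ U ∩ reebCover} := by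
  obtain ⟨U, F, hU, hq, hF, hs, hp, hh⟩ := hf q
  classical
  choose S hS hS' using hF
  let G : reebCover → reebCover := fun r => if h : r.1 ∈ U then S r h else r
  have hG : ∀ r : reebCover, ∀ h : r.1 ∈ U, G r = S r h := fun r h => dif_pos h
  have hGF : ∀ r ∈ U ∩ reebCover, ambientExt G r = F r := fun r hr => by
    rw [ambientExt_of_mem G hr.2, hG ⟨r, hr.2⟩ hr.1, hS]
  refine ⟨U, G, hU, hq, ?_, ?_, hs.congr hGF, ?_, fun x => (hh x).congr fun z hz => ?_⟩
  · rw [Topology.IsInducing.subtypeVal.continuousAt_iff]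
    have h1 : ContinuousWithinAt F (U ∩ reebCover) q.1 := hs.continuousOn _ ⟨hq, q.2⟩
    have h2 : Tendsto (fun r : reebCover => F r.1) (𝓝 q) (𝓝 (F q.1)) := by
      refine h1.tendsto.comp (tendsto_nhdsWithin_iff.2 ⟨continuous_subtype_val.continuousAt, ?_⟩)
      filter_upwards [continuous_subtype_val.continuousAt.preimage_mem_nhds (hU.mem_nhds hq)]
        with r hr using ⟨hr, r.2⟩
    have h3 : (G q).1 = F q.1 := by rw [hG q hq, hS]
    rw [ContinuousAt, Function.comp_apply, h3]
    refine h2.congr' ?_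
    filter_upwards [continuous_subtype_val.continuousAt.preimage_mem_nhds (hU.mem_nhds hq)]
      with r hr
    rw [Function.comp_apply, hG r hr, hS]
  · intro r hr
    rw [hG r hr, hS']
  · intro r r' hr hr' h
    have := hp r.1 ⟨hr, r.2⟩ r'.1 ⟨hr', r'.2⟩ (congrArg NNReal.toReal h)
    rw [← hGF _ ⟨hr, r.2⟩, ← hGF _ ⟨hr', r'.2⟩, ambientExt_apply, ambientExt_apply] at this
    exact NNReal.eq this
  · simp only [hGF _ hz]

theorem IsLeafwiseHolomorphic.continuous_comp_reebProj (h : IsExpanding lam mu φ)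
    {f : Reeb lam mu φ → Reeb lam mu φ} (hf : IsLeafwiseHolomorphic lam mu φ f) :
    Continuous fun q => f (reebProj lam mu φ q) := by
  refine continuous_iff_continuousAt.2 fun q => ?_
  obtain ⟨U, G, hU, hq, hG, hGp, -⟩ := hf.exists_local_lift q
  refine (h.isCoveringMap.continuous.continuousAt.comp hG).congr ?_
  filter_upwards [continuous_subtype_val.continuousAt.preimage_mem_nhds (hU.mem_nhds hq)]
    with r hr using hGp r hr

/-- Two lifts of the same map differ by a power of `T` near every point. -/
theorem IsExpanding.eventually_eq_zpow (h : IsExpanding lam mu φ) {q : reebCover}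
    {g g' : reebCover → reebCover} (hg : ContinuousAt g q) (hg' : ContinuousAt g' q)
    (heq : ∀ᶠ r in 𝓝 q, reebProj lam mu φ (g r) = reebProj lam mu φ (g' r)) :
    ∃ n : ℤ, ∀ᶠ r in 𝓝 q, g r = (coverMap lam mu φ ^ n : Equiv.Perm _) (g' r) := by
  -- The power is determined at `q`. At a nearby `r` the power `m` that works could differ, but then
  -- `g r` and its translate by `T ^ (n - m)` would both lie in `V`, which forces `m = n`.
  obtain ⟨n, hn⟩ := reebProj_eq_iff.1 heq.self_of_nhds
  obtain ⟨V, hV, hd⟩ := h.exists_nhds_disjoint (g q)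
  have hg'' : ContinuousAt (fun r => (coverMap lam mu φ ^ n : Equiv.Perm _) (g' r)) q :=
    (continuous_coverMap_zpow n).continuousAt.comp hg'
  refine ⟨n, ?_⟩
  filter_upwards [heq, hg hV, hg'' (show V ∈ 𝓝 ((coverMap lam mu φ ^ n : Equiv.Perm _) (g' q)) by rwa [← hn])] with r hr hr1 hr2
  obtain ⟨m, hm⟩ := reebProj_eq_iff.1 hr
  have e : g r = (coverMap lam mu φ ^ (m - n) : Equiv.Perm _)
      ((coverMap lam mu φ ^ n : Equiv.Perm _) (g' r)) := by
    rw [← Equiv.Perm.mul_apply, ← zpow_add, sub_add_cancel, hm]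
  have := hd (m - n) _ hr2 (e ▸ hr1)
  rw [e, this, zpow_zero, Equiv.Perm.one_apply]

/-- A continuous lift of a leafwise holomorphic self-map of `R` is leafwise holomorphic. -/
theorem IsLeafwiseHolomorphic.isLeafwiseMap_lift (h : IsExpanding lam mu φ)
    {f : Reeb lam mu φ → Reeb lam mu φ} (hf : IsLeafwiseHolomorphic lam mu φ f)
    {g : reebCover → reebCover} (hgc : Continuous g)
    (hg : ∀ q, reebProj lam mu φ (g q) = f (reebProj lam mu φ q)) : IsLeafwiseMap g := by
  -- Locally `g` is a power of `T` composed with a local representative `G` of `f`. Powers of `T`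
  -- are diagonal, so each property of `G` passes to `g`; constancy of the height along a leaf then
  -- follows from its connectedness.
  have key : ∀ q : reebCover, ∃ (U : Set (ℂ × ℂ × ℝ)) (G : reebCover → reebCover) (n : ℤ),
      IsOpen U ∧ q.1 ∈ U ∧
      (∀ r : reebCover, r.1 ∈ U → g r = diagMap (lam ^ n) (mu ^ n) (φ ^ n) (G r)) ∧
      ContDiffOn ℝ ∞ (ambientExt G) (U ∩ reebCover) ∧
      (∀ r r' : reebCover, r.1 ∈ U → r'.1 ∈ U → height r = height r' →
        height (G r) = height (G r')) ∧
      ∀ x : ℝ, DifferentiableOn ℂ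
        (fun z : ℂ × ℂ => ((ambientExt G (z.1, z.2, x)).1, (ambientExt G (z.1, z.2, x)).2.1))
        {z | (z.1, z.2, x) ∈ U ∩ reebCover} := by
    intro q
    obtain ⟨U, G, hU, hq, hG, hGp, hs, hp, hh⟩ := hf.exists_local_lift q
    obtain ⟨n, hn⟩ := h.eventually_eq_zpow hgc.continuousAt hG (by
      filter_upwards [continuous_subtype_val.continuousAt.preimage_mem_nhds (hU.mem_nhds hq)]
        with r hr
      rw [hg, hGp r hr])
    obtain ⟨t, ht, hto, hqt⟩ := eventually_nhds_iff.1 hn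
    obtain ⟨V, hV, rfl⟩ := isOpen_induced_iff.1 hto
    refine ⟨U ∩ V, G, n, hU.inter hV, ⟨hq, hqt⟩, fun r hr => ?_, hs.mono fun r hr =>
      ⟨hr.1.1, hr.2⟩, fun r r' hr hr' => hp r r' hr.1 hr'.1,
      fun x => (hh x).mono fun z hz => ⟨hz.1.1, hz.2⟩⟩
    rw [ht r hr.2, coverMap_zpow]
    rfl
  refine ⟨fun q hq => ?_, fun q r hqr => ?_, fun x z hz => ?_⟩
  · obtain ⟨U, G, n, hU, hqU, hG, hs, -, -⟩ := key ⟨q, hq⟩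
    have hA : ContDiffOn ℝ ∞ (fun p : ℂ × ℂ × ℝ => (((lam ^ n : ℂˣ) : ℂ) * p.1,
        ((mu ^ n : ℂˣ) : ℂ) * p.2.1, (((φ ^ n : DiffHalfLine).1 p.2.2.toNNReal : ℝ≥0) : ℝ)))
        {p | 0 ≤ p.2.2} := by
      have hφ : ContDiffOn ℝ ∞ (fun p : ℂ × ℂ × ℝ =>
          (((φ ^ n : DiffHalfLine).1 p.2.2.toNNReal : ℝ≥0) : ℝ)) {p | 0 ≤ p.2.2} :=
        ContDiffOn.comp (t := Set.Ici 0)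
          (g := fun x : ℝ => (((φ ^ n : DiffHalfLine).1 x.toNNReal : ℝ≥0) : ℝ))
          (φ ^ n : DiffHalfLine).2.1
          (contDiff_snd.comp contDiff_snd).contDiffOn fun p hp => hp
      exact (contDiff_const.mul contDiff_fst).contDiffOn.prodMk
        ((contDiff_const.mul (contDiff_fst.comp contDiff_snd)).contDiffOn.prodMk hφ)
    have hAG := (hA.comp hs fun r hr => by
      rw [ambientExt_of_mem G hr.2]
      exact (G ⟨r, hr.2⟩).2.1) q ⟨hqU, hq⟩
    rw [← contDiffWithinAt_inter' (hU.mem_nhds hqU |> mem_nhdsWithin_of_mem_nhds),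
      Set.inter_comm]
    refine hAG.congr_of_mem (fun r hr => ?_) ⟨hqU, hq⟩
    rw [ambientExt_of_mem g hr.2, hG ⟨r, hr.2⟩ hr.1, Function.comp_apply,
      ambientExt_of_mem G hr.2]
    simp only [diagMap, height]
    congr 3
    exact congrArg _ (NNReal.eq (Real.coe_toNNReal _ (G ⟨r, hr.2⟩).2.1).symm)
  · refine eq_of_height_eq (fun q => height (g q)) (fun q => ?_) hqr
    obtain ⟨U, G, n, hU, hqU, hG, -, hp, -⟩ := key q
    filter_upwards [continuous_subtype_val.continuousAt.preimage_mem_nhds (hU.mem_nhds hqU)]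
      with r hr hrq
    rw [hG r hr, hG q hqU]
    exact congrArg (φ ^ n : DiffHalfLine).1 (hp r q hr hqU hrq)
  · obtain ⟨U, G, n, hU, hqU, hG, -, -, hh⟩ := key ⟨_, hz⟩
    have hd := hh x z ⟨hqU, hz⟩
    have hd' : DifferentiableWithinAt ℂ (fun z : ℂ × ℂ =>
        (((lam ^ n : ℂˣ) : ℂ) * (ambientExt G (z.1, z.2, x)).1,
          ((mu ^ n : ℂˣ) : ℂ) * (ambientExt G (z.1, z.2, x)).2.1))
        {z | (z.1, z.2, x) ∈ U ∩ reebCover} z :=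
      (hd.fst.const_mul _).prodMk (hd.snd.const_mul _)
    have hUx : {z : ℂ × ℂ | (z.1, z.2, x) ∈ U} ∈ 𝓝 z := by
      refine ContinuousAt.preimage_mem_nhds ?_ (hU.mem_nhds hqU)
      fun_prop
    have hw0 : ∀ w ∈ {z : ℂ × ℂ | (z.1, z.2, x) ∈ U ∩ reebCover},
        ((ambientExt g (w.1, w.2, x)).1, (ambientExt g (w.1, w.2, x)).2.1) =
          (((lam ^ n : ℂˣ) : ℂ) * (ambientExt G (w.1, w.2, x)).1,
            ((mu ^ n : ℂˣ) : ℂ) * (ambientExt G (w.1, w.2, x)).2.1) := fun w hw => by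
      rw [ambientExt_of_mem g hw.2, hG ⟨_, hw.2⟩ hw.1, ambientExt_of_mem G hw.2]
      rfl
    rw [← differentiableWithinAt_inter' (mem_nhdsWithin_of_mem_nhds hUx), Set.inter_comm]
    refine DifferentiableWithinAt.congr hd' hw0 (hw0 z ⟨hqU, hz⟩)

end Lift
end

/-! ### The lift fixing the boundary -/

noncomputable section

open Topology Filter

section RelLift

variable {lam mu : ℂˣ} {φ : DiffHalfLine}

theorem IsExpanding.isRelLift_unique (h : IsExpanding lam mu φ)
    {f : Reeb lam mu φ → Reeb lam mu φ} {g g' : reebCover → reebCover}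
    (hg : IsRelLift lam mu φ f g) (hg' : IsRelLift lam mu φ f g') : g = g' := by
  refine h.isCoveringMap.eq_of_comp_eq hg.1 hg'.1 (funext fun q => ?_)
    ⟨(1, 0, 0), le_rfl, by simp⟩ ?_
  · rw [Function.comp_apply, Function.comp_apply, hg.2.1, hg'.2.1]
  · rw [hg.2.2 _ rfl, hg'.2.2 _ rfl]

theorem IsExpanding.exists_isRelLift (h : IsExpanding lam mu φ)
    {f : Reeb lam mu φ → Reeb lam mu φ} (hf : IsLeafwiseHolomorphic lam mu φ f)
    (hfix : ∀ y ∈ reebBoundary lam mu φ, f y = y) : ∃ g, IsRelLift lam mu φ f g := by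
  have hfix' : ∀ q, height q = 0 → f (reebProj lam mu φ q) = reebProj lam mu φ q :=
    fun q hq => hfix _ ⟨q, hq, rfl⟩
  let e : reebCover := ⟨(1, 0, 0), le_rfl, by simp⟩
  have he : height e = 0 := NNReal.eq rfl
  obtain ⟨g, ⟨hge, hg⟩, -⟩ := h.isCoveringMap.existsUnique_continuousMap_lifts
    ⟨_, hf.continuous_comp_reebProj h⟩ e e (hfix' e he).symm
  have hg' : ∀ q, reebProj lam mu φ (g q) = f (reebProj lam mu φ q) := congrFun hg
  refine ⟨g, g.continuous, hg', fun q hq => ?_⟩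
  -- The lift is normalized at a single boundary point `e`. On the connected boundary, `g` and the
  -- identity both lift the same map and agree at `e`, so they coincide there.
  have := h.isCoveringMap.eqOn_of_comp_eqOn (isPreconnected_height_fiber 0)
    g.continuous.continuousOn continuousOn_id
    (fun r hr => by rw [Function.comp_apply, hg', hfix' r hr]; rfl) he hge
  exact this hq

theorem IsRelLift.comp {f f' : Reeb lam mu φ → Reeb lam mu φ} {g g' : reebCover → reebCover}
    (hg : IsRelLift lam mu φ f g) (hg' : IsRelLift lam mu φ f' g') :
    IsRelLift lam mu φ (f ∘ f') (g ∘ g') :=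
  ⟨hg.1.comp hg'.1, fun q => by simp only [Function.comp_apply, hg.2.1, hg'.2.1],
    fun q hq => by rw [Function.comp_apply, hg'.2.2 q hq, hg.2.2 q hq]⟩

theorem isRelLift_id : IsRelLift lam mu φ id id :=
  ⟨continuous_id, fun _ => rfl, fun _ _ => rfl⟩

/-- Conjugating `g` by `T` gives another lift of `f` fixing the boundary, since `T` preserves the
boundary; uniqueness identifies the two. -/
theorem IsExpanding.isRelLift_coverMap (h : IsExpanding lam mu φ)
    {f : Reeb lam mu φ → Reeb lam mu φ} {g : reebCover → reebCover}
    (hg : IsRelLift lam mu φ f g) (q : reebCover) :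
    g (coverMap lam mu φ q) = coverMap lam mu φ (g q) := by
  have hT : Continuous (coverMap lam mu φ) := continuous_diagMap _ _ _
  have hT' : Continuous (coverMap lam mu φ).symm := continuous_diagMap _ _ _
  have hp : ∀ r, reebProj lam mu φ ((coverMap lam mu φ).symm r) = reebProj lam mu φ r := by
    intro r
    rw [← reebProj_coverMap, Equiv.apply_symm_apply]
  have hconj : IsRelLift lam mu φ f
      ((coverMap lam mu φ).symm ∘ g ∘ coverMap lam mu φ) := by
    refine ⟨hT'.comp (hg.1.comp hT), fun r => ?_, fun r hr => ?_⟩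
    · rw [Function.comp_apply, hp, Function.comp_apply, hg.2.1, reebProj_coverMap]
    · rw [Function.comp_apply, Function.comp_apply, hg.2.2, Equiv.symm_apply_apply]
      rw [height_coverMap, hr, DiffHalfLine.apply_zero]
  have := congrFun (h.isRelLift_unique hconj hg) q
  rw [← this, Function.comp_apply, Equiv.apply_symm_apply, Function.comp_apply]

theorem autReebRel_fixes (f : autReebRel lam mu φ) :
    ∀ y ∈ reebBoundary lam mu φ, f.1 y = y :=
  (mem_fixingSubgroup_iff _).1 f.2.2

theorem IsExpanding.exists_isRelLift_autReebRel (h : IsExpanding lam mu φ)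
    (f : autReebRel lam mu φ) : ∃ g, IsRelLift lam mu φ f.1 g :=
  h.exists_isRelLift f.2.1.1 (autReebRel_fixes f)

/-- The lift of an element of `Aut(R, H)` that is the identity on the boundary. -/
def relLift (h : IsExpanding lam mu φ) (f : autReebRel lam mu φ) : reebCover → reebCover :=
  (h.exists_isRelLift_autReebRel f).choose

theorem isRelLift_relLift (h : IsExpanding lam mu φ) (f : autReebRel lam mu φ) :
    IsRelLift lam mu φ f.1 (relLift h f) :=
  (h.exists_isRelLift_autReebRel f).choose_spec

theorem eq_relLift (h : IsExpanding lam mu φ) {f : autReebRel lam mu φ}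
    {g : reebCover → reebCover} (hg : IsRelLift lam mu φ f.1 g) : g = relLift h f :=
  h.isRelLift_unique hg (isRelLift_relLift h f)

theorem relLift_mul (h : IsExpanding lam mu φ) (f f' : autReebRel lam mu φ) :
    relLift h (f * f') = relLift h f ∘ relLift h f' :=
  by
  have hc : IsRelLift lam mu φ (f * f').1 (relLift h f ∘ relLift h f') :=
    (isRelLift_relLift h f).comp (isRelLift_relLift h f')
  exact (eq_relLift h hc).symm

theorem relLift_one (h : IsExpanding lam mu φ) : relLift h 1 = id :=
  (eq_relLift h isRelLift_id).symm

theorem relLift_injective (h : IsExpanding lam mu φ) : Function.Injective (relLift h) := by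
  intro f f' hff
  refine Subtype.ext (Equiv.ext fun y => ?_)
  obtain ⟨q, rfl⟩ := h.isQuotientCoveringMap.surjective y
  rw [← (isRelLift_relLift h f).2.1, hff, (isRelLift_relLift h f').2.1]

theorem relLift_coverMap (h : IsExpanding lam mu φ) (f : autReebRel lam mu φ) (q : reebCover) :
    relLift h f (coverMap lam mu φ q) = coverMap lam mu φ (relLift h f q) :=
  h.isRelLift_coverMap (isRelLift_relLift h f) q

theorem isLeafwiseMap_relLift (h : IsExpanding lam mu φ) (f : autReebRel lam mu φ) :
    IsLeafwiseMap (relLift h f) :=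
  IsLeafwiseHolomorphic.isLeafwiseMap_lift h f.2.1.1 (isRelLift_relLift h f).1
    (isRelLift_relLift h f).2.1

theorem IsLeafwiseMap.isLeafwiseHolomorphic {g : reebCover → reebCover} (hg : IsLeafwiseMap g)
    {f : Reeb lam mu φ → Reeb lam mu φ}
    (hgf : ∀ q, reebProj lam mu φ (g q) = f (reebProj lam mu φ q)) :
    IsLeafwiseHolomorphic lam mu φ f := by
  refine fun q => ⟨Set.univ, ambientExt g, isOpen_univ, trivial,
    fun r _ => ⟨g r, (ambientExt_apply g r).symm, hgf r⟩, ?_, ?_, fun x => ?_⟩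
  · rw [Set.univ_inter]
    exact hg.contDiffOn
  · rintro r ⟨-, hr⟩ r' ⟨-, hr'⟩ hrr
    rw [ambientExt_of_mem g hr, ambientExt_of_mem g hr']
    exact congrArg NNReal.toReal (hg.height_eq ⟨r, hr⟩ ⟨r', hr'⟩ (NNReal.eq hrr))
  · exact (hg.differentiableOn x).mono fun z hz => hz.2

theorem IsLeafwiseMap.continuous {g : reebCover → reebCover} (hg : IsLeafwiseMap g) :
    Continuous g := by
  rw [Topology.IsInducing.subtypeVal.continuous_iff]
  have := continuousOn_iff_continuous_domRestrict.1 hg.contDiffOn.continuousOn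
  exact this.congr fun q => ambientExt_apply g q

/-- A leafwise holomorphic automorphism of `R̃` which commutes with `T` and is the identity on the
boundary descends to an element of `Aut(R, H)`. -/
theorem exists_relLift_eq (h : IsExpanding lam mu φ) (g : Equiv.Perm reebCover)
    (hg : IsLeafwiseMap g) (hg' : IsLeafwiseMap g.symm)
    (hT : ∀ q, g (coverMap lam mu φ q) = coverMap lam mu φ (g q))
    (hb : ∀ q, height q = 0 → g q = q) : ∃ f : autReebRel lam mu φ, relLift h f = g := by
  have hz : ∀ (n : ℤ) q, g ((coverMap lam mu φ ^ n : Equiv.Perm _) q) =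
      (coverMap lam mu φ ^ n : Equiv.Perm _) (g q) := by
    have hc : Commute g (coverMap lam mu φ) := Equiv.ext hT
    exact fun n => Equiv.ext_iff.1 (hc.zpow_right n).eq
  have hz' : ∀ (n : ℤ) q, g.symm ((coverMap lam mu φ ^ n : Equiv.Perm _) q) =
      (coverMap lam mu φ ^ n : Equiv.Perm _) (g.symm q) := fun n q => by
    rw [Equiv.symm_apply_eq, hz, Equiv.apply_symm_apply]
  have hm : ∀ q r, reebProj lam mu φ q = reebProj lam mu φ r →
      reebProj lam mu φ (g q) = reebProj lam mu φ (g r) := by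
    intro q r hqr
    obtain ⟨n, rfl⟩ := reebProj_eq_iff.1 hqr
    rw [hz, reebProj_zpow]
  have hm' : ∀ q r, reebProj lam mu φ q = reebProj lam mu φ r →
      reebProj lam mu φ (g.symm q) = reebProj lam mu φ (g.symm r) := by
    intro q r hqr
    obtain ⟨n, rfl⟩ := reebProj_eq_iff.1 hqr
    rw [hz', reebProj_zpow]
  let f : Equiv.Perm (Reeb lam mu φ) :=
    { toFun := Quotient.lift (fun q => reebProj lam mu φ (g q))
        fun q r hqr => hm q r (Quotient.sound hqr)
      invFun := Quotient.lift (fun q => reebProj lam mu φ (g.symm q))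
        fun q r hqr => hm' q r (Quotient.sound hqr)
      left_inv := fun y => by
        obtain ⟨q, rfl⟩ := Quotient.exists_rep y
        exact congrArg _ (g.symm_apply_apply q)
      right_inv := fun y => by
        obtain ⟨q, rfl⟩ := Quotient.exists_rep y
        exact congrArg _ (g.apply_symm_apply q) }
  have hf : ∀ q, reebProj lam mu φ (g q) = f (reebProj lam mu φ q) := fun q => rfl
  have hf' : ∀ q, reebProj lam mu φ (g.symm q) = f⁻¹ (reebProj lam mu φ q) := fun q => rfl
  have hmem : f ∈ autReebRel lam mu φ := by
    refine ⟨⟨hg.isLeafwiseHolomorphic hf, hg'.isLeafwiseHolomorphic hf'⟩,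
      (mem_fixingSubgroup_iff _).2 ?_⟩
    rintro _ ⟨q, hq, rfl⟩
    exact (hf q).symm.trans (congrArg _ (hb q hq))
  exact ⟨⟨f, hmem⟩, (eq_relLift h ⟨hg.continuous, hf, hb⟩).symm⟩

end RelLift

/-! ### The projection onto the centralizer -/

section HeightHom

variable {lam mu : ℂˣ} {φ : DiffHalfLine}

/-- The point `(1, 0, x)` of `R̃`. -/
def basePoint (x : ℝ≥0) : reebCover := ⟨(1, 0, x), x.2, by simp⟩

theorem height_basePoint (x : ℝ≥0) : height (basePoint x) = x := NNReal.eq rfl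

theorem height_relLift (h : IsExpanding lam mu φ) (f : autReebRel lam mu φ) (q : reebCover) :
    height (relLift h f q) = height (relLift h f (basePoint (height q))) :=
  (isLeafwiseMap_relLift h f).height_eq _ _ (height_basePoint _).symm

theorem height_relLift_mul (h : IsExpanding lam mu φ) (f f' : autReebRel lam mu φ) (x : ℝ≥0) :
    height (relLift h (f * f') (basePoint x)) =
      height (relLift h f (basePoint (height (relLift h f' (basePoint x))))) := by
  rw [relLift_mul, Function.comp_apply, height_relLift]

/-- The curve `x ↦ (1, 0, x)` stays in `R̃` down to `x = 0`, so the height of the lift can be read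
along it with smoothness up to the boundary. -/
theorem smoothOnHalfLine_height_relLift (h : IsExpanding lam mu φ) (f : autReebRel lam mu φ) :
    SmoothOnHalfLine fun x => (height (relLift h f (basePoint x)) : ℝ) := by
  have h1 := (contDiff_snd.comp contDiff_snd).comp_contDiffOn
    (isLeafwiseMap_relLift h f).contDiffOn
  have h2 : ContDiff ℝ ∞ fun x : ℝ => ((1, 0, x) : ℂ × ℂ × ℝ) := by fun_prop
  refine (h1.comp (s := Set.Ici 0) h2.contDiffOn fun x hx => ⟨hx, by simp⟩).congr
    fun x hx => ?_
  have hb : ((1, 0, x) : ℂ × ℂ × ℝ) = (basePoint x.toNNReal).1 := by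
    simp only [basePoint, Real.coe_toNNReal x hx]
  simp only [Function.comp_apply, hb, ambientExt_apply]
  rfl

/-- The diffeomorphism of `[0, ∞)` induced by an element of `Aut(R, H)`. -/
def heightDiffeo (h : IsExpanding lam mu φ) (f : autReebRel lam mu φ) : DiffHalfLine :=
  ⟨{ toFun := fun x => height (relLift h f (basePoint x))
     invFun := fun x => height (relLift h f⁻¹ (basePoint x))
     left_inv := fun x => by
      beta_reduce
      rw [← height_relLift_mul, inv_mul_cancel, relLift_one]
      exact height_basePoint x
     right_inv := fun x => by
      beta_reduce
      rw [← height_relLift_mul, mul_inv_cancel, relLift_one]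
      exact height_basePoint x },
    smoothOnHalfLine_height_relLift h f, smoothOnHalfLine_height_relLift h f⁻¹⟩

theorem height_relLift_eq (h : IsExpanding lam mu φ) (f : autReebRel lam mu φ) (q : reebCover) :
    height (relLift h f q) = (heightDiffeo h f).1 (height q) := height_relLift h f q

theorem heightDiffeo_mem (h : IsExpanding lam mu φ) (f : autReebRel lam mu φ) :
    heightDiffeo h f ∈ diffCentralizer φ := by
  rw [diffCentralizer, Subgroup.mem_centralizer_singleton_iff]
  refine Subtype.ext (Equiv.ext fun x => ?_)
  change (heightDiffeo h f).1 (φ.1 x) = φ.1 ((heightDiffeo h f).1 x)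
  have := congrArg height (relLift_coverMap h f (basePoint x))
  rwa [height_relLift_eq, height_coverMap, height_coverMap, height_relLift_eq,
    height_basePoint] at this

/-- The homomorphism `P : Aut(R, H) → Z_φ`. -/
def heightHom (h : IsExpanding lam mu φ) : autReebRel lam mu φ →* diffCentralizer φ where
  toFun f := ⟨heightDiffeo h f, heightDiffeo_mem h f⟩
  map_one' := Subtype.ext (Subtype.ext (Equiv.ext fun x => by
    change height (relLift h 1 (basePoint x)) = x
    rw [relLift_one]
    exact height_basePoint x))
  map_mul' f f' := Subtype.ext (Subtype.ext (Equiv.ext (height_relLift_mul h f f')))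

theorem height_relLift_eq_heightHom (h : IsExpanding lam mu φ) (f : autReebRel lam mu φ)
    (q : reebCover) : height (relLift h f q) = (heightHom h f).1.1 (height q) :=
  height_relLift h f q

theorem mem_ker_heightHom_iff (h : IsExpanding lam mu φ) {f : autReebRel lam mu φ} :
    f ∈ (heightHom h).ker ↔ ∀ q, height (relLift h f q) = height q := by
  rw [MonoidHom.mem_ker]
  refine ⟨fun hf q => ?_, fun hf => Subtype.ext (Subtype.ext (Equiv.ext fun x => ?_))⟩
  · rw [height_relLift_eq_heightHom, hf]
    rfl
  · exact (hf _).trans (height_basePoint x)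

theorem isLeafwiseMap_coverMap_one (ψ : DiffHalfLine) : IsLeafwiseMap (coverMap 1 1 ψ) := by
  have e : ∀ q ∈ reebCover, ambientExt (coverMap 1 1 ψ) q =
      (q.1, q.2.1, ((ψ.1 q.2.2.toNNReal : ℝ≥0) : ℝ)) := by
    intro q hq
    rw [ambientExt_of_mem _ hq]
    have : q.2.2.toNNReal = height ⟨q, hq⟩ := NNReal.eq (Real.coe_toNNReal _ hq.1)
    rw [this]
    simp [coverMap, diagMap]
  refine ⟨?_, fun q r hqr => ?_, fun x => ?_⟩
  · have hψ : ContDiffOn ℝ ∞ (fun p : ℂ × ℂ × ℝ => ((ψ.1 p.2.2.toNNReal : ℝ≥0) : ℝ))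
        reebCover :=
      ContDiffOn.comp (t := Set.Ici 0) (g := fun x : ℝ => ((ψ.1 x.toNNReal : ℝ≥0) : ℝ))
        ψ.2.1 (contDiff_snd.comp contDiff_snd).contDiffOn fun p hp => hp.1
    exact (contDiff_fst.contDiffOn.prodMk
      ((contDiff_fst.comp contDiff_snd).contDiffOn.prodMk hψ)).congr e
  · rw [height_coverMap, height_coverMap, hqr]
  · refine differentiableOn_id.congr fun z hz => ?_
    simp only [e _ hz, id]

/-- The witness is `id × ψ`, which commutes with `T` exactly because `ψ` commutes with `φ`. -/
theorem heightHom_surjective (h : IsExpanding lam mu φ) :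
    Function.Surjective (heightHom h) := by
  intro ψ
  have hψ : (ψ.1 : DiffHalfLine) * φ = φ * ψ.1 :=
    Subgroup.mem_centralizer_singleton_iff.1 ψ.2
  obtain ⟨f, hf⟩ := exists_relLift_eq h (coverMap 1 1 ψ.1) (isLeafwiseMap_coverMap_one _) (by
      have : (coverMap 1 1 ψ.1).symm = coverMap 1 1 ψ.1⁻¹ :=
        (map_inv diagHom (1, 1, ψ.1)).symm
      rw [this]
      exact isLeafwiseMap_coverMap_one _)
    (fun q => (diagMap_diagMap _ _ _ _ _ _ q).trans (by
      rw [one_mul, one_mul, hψ]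
      exact (by rw [mul_one, mul_one] : _ = diagMap (lam * 1) (mu * 1) (φ * ψ.1) q).trans
        (diagMap_diagMap _ _ _ _ _ _ q).symm))
    (fun q hq => by
      refine Subtype.ext ?_
      have h0 : q.1.2.2 = 0 := congrArg NNReal.toReal hq
      simp [coverMap, diagMap, hq, DiffHalfLine.apply_zero, Prod.ext_iff, h0])
  refine ⟨f, Subtype.ext (Subtype.ext (Equiv.ext fun x => ?_))⟩
  change height (relLift h f (basePoint x)) = _
  rw [hf, height_coverMap, height_basePoint]

end HeightHom
end

/-! ### Growth estimates and the form of kernel elements -/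

noncomputable section

open Topology Filter

section Growth

/-- The backward orbit decreases, so it converges to a fixed point of `φ⁻¹`, and `0` is the only
one. -/
theorem tendsto_symm_iterate {φ : DiffHalfLine} (hφ : ∀ x : ℝ≥0, 0 < x → x < φ.1 x) (x : ℝ≥0) :
    Tendsto (fun n => φ.1.symm^[n] x) atTop (𝓝 0) := by
  have hle : ∀ y, φ.1.symm y ≤ y := fun y => by
    rcases eq_or_ne (φ.1.symm y) 0 with h0 | h0
    · rw [h0]
      exact zero_le
    · simpa using (hφ _ (pos_iff_ne_zero.2 h0)).le
  have hanti : Antitone fun n => φ.1.symm^[n] x := antitone_nat_of_succ_le fun n => by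
    rw [Function.iterate_succ_apply']
    exact hle _
  have hlim := tendsto_atTop_ciInf hanti (OrderBot.bddBelow _)
  have hfix := isFixedPt_of_tendsto_iterate hlim (DiffHalfLine.continuous φ⁻¹).continuousAt
  have h0 : (⨅ n, φ.1.symm^[n] x) = 0 := by
    by_contra hne
    have h1 := hφ _ (pos_iff_ne_zero.2 hne)
    have h2 : φ.1 (⨅ n, φ.1.symm^[n] x) = ⨅ n, φ.1.symm^[n] x :=
      ((Equiv.symm_apply_eq _).1 hfix.eq).symm
    exact h1.ne' h2
  rwa [h0] at hlim

/-- An entire function of small growth along a geometric sequence of radii is a polynomial. -/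
theorem exists_eq_sum_of_geometric_growth {F : ℂ → ℂ} (hF : Differentiable ℂ F) {r C : ℝ}
    (hr : 1 < r) (hC : 0 ≤ C) {k : ℕ} (hCk : C ≤ r ^ k)
    (hb : ∀ ε > 0, ∀ᶠ n : ℕ in atTop, ∀ z, ‖z‖ ≤ r ^ n → ‖F z‖ ≤ ε * C ^ n) :
    ∃ a : Fin k → ℂ, ∀ z, F z = ∑ j, a j * z ^ (j : ℕ) := by
  -- On the circle of radius `r ^ n`, Cauchy's estimate bounds the derivative by `ε C ^ n / r ^ (n
  -- m) ≤ ε` once `m!` is absorbed into the choice of `ε`. The free factor `ε` is what settles the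
  -- case `C = r ^ k`.
  have h0 : ∀ m, k ≤ m → iteratedDeriv m F 0 = 0 := by
    intro m hm
    refine norm_le_zero_iff.1 (le_of_forall_pos_le_add fun ε hε => ?_)
    have hfac : (0 : ℝ) < m.factorial := by positivity
    obtain ⟨n, hn⟩ := (hb (ε / m.factorial) (by positivity)).exists
    have hrn : 0 < r ^ n := by positivity
    have := Complex.norm_iteratedDeriv_le_of_forall_mem_sphere_norm_le m hrn
      (hF.diffContOnCl (s := Metric.ball (0 : ℂ) (r ^ n)))
      (fun z hz => hn z (by simpa using hz.le))
    rw [zero_add]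
    refine this.trans ((div_le_iff₀ (by positivity)).2 ?_)
    have h1 : C ^ n ≤ (r ^ n) ^ m := by
      calc C ^ n ≤ (r ^ k) ^ n := pow_le_pow_left₀ hC hCk n
        _ = (r ^ n) ^ k := by rw [← pow_mul, ← pow_mul, mul_comm]
        _ ≤ (r ^ n) ^ m := pow_le_pow_right₀ (one_le_pow₀ hr.le) hm
    calc (m.factorial : ℝ) * (ε / m.factorial * C ^ n) = ε * C ^ n := by field_simp
      _ ≤ ε * (r ^ n) ^ m := by gcongr
  refine ⟨fun j => ((j : ℕ).factorial : ℂ)⁻¹ * iteratedDeriv j F 0, fun z => ?_⟩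
  have := Complex.taylorSeries_eq_of_entire' 0 z hF
  rw [← this, tsum_eq_sum (s := Finset.range k), Finset.sum_range]
  · simp
  · intro m hm
    rw [h0 m (by simpa using hm)]
    simp

variable {lam mu : ℂˣ} {φ : DiffHalfLine}

/-- A function on `R̃` which is smooth, zero on the boundary, holomorphic along the interior leaves
and multiplied by `c` under `T`. -/
structure IsEquivariantFun (lam mu : ℂˣ) (φ : DiffHalfLine) (c : ℂ) (U : ℂ × ℂ × ℝ → ℂ) : Prop where
  contDiffOn : ContDiffOn ℝ ∞ U reebCover
  eq_zero : ∀ q : reebCover, height q = 0 → U q.1 = 0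
  differentiable : ∀ x : ℝ, 0 < x → Differentiable ℂ fun z : ℂ × ℂ => U (z.1, z.2, x)
  map_coverMap : ∀ q : reebCover, U (coverMap lam mu φ q).1 = c * U q.1

theorem mem_reebCover_of_pos {x : ℝ} (hx : 0 < x) (z w : ℂ) : (z, w, x) ∈ reebCover :=
  ⟨hx.le, fun h => hx.ne' (by simpa using congrArg (fun q : ℂ × ℂ × ℝ => q.2.2) h)⟩

theorem mem_reebCover_of_ne_left {x : ℝ} (hx : 0 ≤ x) {z : ℂ} (hz : z ≠ 0) (w : ℂ) :
    (z, w, x) ∈ reebCover :=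
  ⟨hx, fun h => hz (congrArg (fun q : ℂ × ℂ × ℝ => q.1) h)⟩

theorem mem_reebCover_of_ne_right {x : ℝ} (hx : 0 ≤ x) (z : ℂ) {w : ℂ} (hw : w ≠ 0) :
    (z, w, x) ∈ reebCover :=
  ⟨hx, fun h => hw (congrArg (fun q : ℂ × ℂ × ℝ => q.2.1) h)⟩

/-- Continuity at the boundary gives no control near the missing point `(O, 0)`. It is applied only
on the compact set `|z₁| = 1`, `|z₂| ≤ 1`, and the maximum principle in `z₁` fills in the bidisc at
positive height. -/
theorem IsEquivariantFun.eventually_norm_le {c : ℂ} {U : ℂ × ℂ × ℝ → ℂ}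
    (hU : IsEquivariantFun lam mu φ c U) {ε : ℝ} (hε : 0 < ε) :
    ∀ᶠ x : ℝ in 𝓝 0, 0 < x → ∀ z w : ℂ, ‖z‖ ≤ 1 → ‖w‖ ≤ 1 → ‖U (z, w, x)‖ ≤ ε := by
  have hK : IsCompact (Metric.sphere (0 : ℂ) 1 ×ˢ Metric.closedBall (0 : ℂ) 1) :=
    (isCompact_sphere _ _).prod (isCompact_closedBall _ _)
  have key : ∀ᶠ x : ℝ in 𝓝 0, ∀ p ∈ Metric.sphere (0 : ℂ) 1 ×ˢ Metric.closedBall (0 : ℂ) 1,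
      (p.1, p.2, x) ∈ reebCover → ‖U (p.1, p.2, x)‖ < ε := by
    refine hK.eventually_forall_of_forall_eventually fun p hp => ?_
    have hp0 : p.1 ≠ 0 := by
      rintro h0
      have := hp.1
      simp [h0] at this
    have hm := mem_reebCover_of_ne_left le_rfl hp0 p.2
    have h1 : ∀ᶠ q in 𝓝[reebCover] (p.1, p.2, (0 : ℝ)), ‖U q‖ < ε := by
      refine (hU.contDiffOn.continuousOn _ hm).norm.eventually (gt_mem_nhds ?_)
      have h0 : U (p.1, p.2, 0) = 0 := hU.eq_zero ⟨_, hm⟩ (NNReal.eq rfl)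
      simpa [h0] using hε
    have h2 : ContinuousAt (fun s : ℝ × ℂ × ℂ => (s.2.1, s.2.2, s.1)) (0, p) := by fun_prop
    exact h2.eventually (eventually_nhdsWithin_iff.1 h1)
  filter_upwards [key] with x hx h0 z w hz hw
  have hd : Differentiable ℂ fun t => U (t, w, x) :=
    (hU.differentiable x h0).comp (differentiable_id.prodMk (differentiable_const w))
  refine Complex.norm_le_of_forall_mem_frontier_norm_le (U := Metric.ball 0 1)
    Metric.isBounded_ball hd.diffContOnCl (fun t ht => ?_) (z := z) ?_
  · rw [frontier_ball (0 : ℂ) one_ne_zero] at ht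
    exact (hx (t, w) ⟨ht, by simpa using hw⟩ (mem_reebCover_of_pos h0 _ _)).le
  · rw [closure_ball (0 : ℂ) one_ne_zero]
    simpa using hz

theorem IsEquivariantFun.eq_mul {c : ℂ} {U : ℂ × ℂ × ℝ → ℂ}
    (hU : IsEquivariantFun lam mu φ c U) {x : ℝ≥0} (hx : 0 < φ.1.symm x) (z w : ℂ) :
    U (z, w, x) = c * U ((lam : ℂ)⁻¹ * z, (mu : ℂ)⁻¹ * w, φ.1.symm x) := by
  have := hU.map_coverMap ⟨((lam : ℂ)⁻¹ * z, (mu : ℂ)⁻¹ * w, φ.1.symm x),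
    mem_reebCover_of_pos hx _ _⟩
  rw [← this]
  have e : height ⟨((lam : ℂ)⁻¹ * z, (mu : ℂ)⁻¹ * w, φ.1.symm x),
    mem_reebCover_of_pos hx _ _⟩ = φ.1.symm x := NNReal.eq rfl
  simp [coverMap, diagMap, e]

/-- Applying `T⁻¹` `n` times brings the large polydisc back to the unit bidisc at height `φ⁻ⁿ x`,
and each application costs a factor `|c|`. -/
theorem IsEquivariantFun.norm_le_pow_mul {c : ℂ} {U : ℂ × ℂ × ℝ → ℂ}
    (hU : IsEquivariantFun lam mu φ c U) {M : ℝ} (n : ℕ) : ∀ {x : ℝ≥0}, 0 < x →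
    (∀ z w : ℂ, ‖z‖ ≤ 1 → ‖w‖ ≤ 1 → ‖U (z, w, φ.1.symm^[n] x)‖ ≤ M) →
    ∀ z w : ℂ, ‖z‖ ≤ ‖(lam : ℂ)‖ ^ n → ‖w‖ ≤ ‖(mu : ℂ)‖ ^ n → ‖U (z, w, x)‖ ≤ M * ‖c‖ ^ n := by
  induction n with
  | zero => simp
  | succ n ih =>
    intro x hx hM z w hz hw
    have hx' : 0 < φ.1.symm x := DiffHalfLine.pos_of_pos φ⁻¹ hx
    have hl : 0 < ‖(lam : ℂ)‖ := norm_pos_iff.2 lam.ne_zero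
    have hm : 0 < ‖(mu : ℂ)‖ := norm_pos_iff.2 mu.ne_zero
    rw [hU.eq_mul hx', norm_mul]
    have := ih hx' (by simpa only [Function.iterate_succ_apply] using hM)
      ((lam : ℂ)⁻¹ * z) ((mu : ℂ)⁻¹ * w)
      (by rw [norm_mul, norm_inv, inv_mul_le_iff₀ hl, ← pow_succ']; exact hz)
      (by rw [norm_mul, norm_inv, inv_mul_le_iff₀ hm, ← pow_succ']; exact hw)
    calc _ ≤ ‖c‖ * (M * ‖c‖ ^ n) := by gcongr
      _ = M * ‖c‖ ^ (n + 1) := by ring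

theorem IsEquivariantFun.eventually_growth (h : IsExpanding lam mu φ) {c : ℂ}
    {U : ℂ × ℂ × ℝ → ℂ} (hU : IsEquivariantFun lam mu φ c U) {x : ℝ≥0} (hx : 0 < x)
    {ε : ℝ} (hε : 0 < ε) : ∀ᶠ n : ℕ in atTop, ∀ z w : ℂ,
      ‖z‖ ≤ ‖(lam : ℂ)‖ ^ n → ‖w‖ ≤ ‖(mu : ℂ)‖ ^ n → ‖U (z, w, x)‖ ≤ ε * ‖c‖ ^ n := by
  have hlim : Tendsto (fun n => ((φ.1.symm^[n] x : ℝ≥0) : ℝ)) atTop (𝓝 0) :=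
    (NNReal.continuous_coe.tendsto 0).comp (tendsto_symm_iterate h.lt_apply x)
  filter_upwards [hlim.eventually (hU.eventually_norm_le hε)] with n hn
  refine hU.norm_le_pow_mul n hx (hn ?_)
  have : ∀ m, 0 < φ.1.symm^[m] x := fun m => by
    induction m with
    | zero => exact hx
    | succ m ih =>
      rw [Function.iterate_succ_apply']
      exact DiffHalfLine.pos_of_pos φ⁻¹ ih
  exact_mod_cast this n

/-- On every interior leaf, an equivariant function is a polynomial in the second coordinate. -/
theorem IsEquivariantFun.exists_eq_sum (h : IsExpanding lam mu φ) {c : ℂ} {U : ℂ × ℂ × ℝ → ℂ}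
    (hU : IsEquivariantFun lam mu φ c U) (hc : ‖c‖ ≤ ‖(lam : ℂ)‖) {k : ℕ}
    (hk : ‖c‖ ≤ ‖(mu : ℂ)‖ ^ k) {x : ℝ≥0} (hx : 0 < x) :
    ∃ a : Fin k → ℂ, ∀ z w : ℂ, U (z, w, x) = ∑ j, a j * w ^ (j : ℕ) := by
  have hd := hU.differentiable x hx
  have h1 : ∀ z w, U (z, w, x) = U (0, w, x) := by
    intro z w
    -- In the first variable the radii are `|λ| ^ n` and `|c| ≤ |λ|`, so `k = 1` applies and only
    -- the constant term survives. A fixed `w` lies within the radius `|μ| ^ n` for large `n`.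
    obtain ⟨a, ha⟩ := exists_eq_sum_of_geometric_growth (F := fun t => U (t, w, x))
      (hd.comp (differentiable_id.prodMk (differentiable_const w)))
      h.one_lt_lam (norm_nonneg c) (k := 1) (by rwa [pow_one]) (fun ε hε => by
        filter_upwards [hU.eventually_growth h hx hε,
          (tendsto_pow_atTop_atTop_of_one_lt h.one_lt_mu).eventually_ge_atTop ‖w‖]
          with n hn hw z hz using hn z w hz hw)
    have ez := ha z
    have e0 := ha 0
    simp only [Finset.univ_unique, Finset.sum_singleton, Fin.default_eq_zero, Fin.val_zero,
      pow_zero] at ez e0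
    rw [ez, e0]
  obtain ⟨a, ha⟩ := exists_eq_sum_of_geometric_growth (F := fun t => U (0, t, x))
    (hd.comp ((differentiable_const (0 : ℂ)).prodMk differentiable_id))
    h.one_lt_mu (norm_nonneg c) hk (fun ε hε => by
      filter_upwards [hU.eventually_growth h hx hε] with n hn w hw
      exact hn 0 w (by rw [norm_zero]; positivity) hw)
  exact ⟨a, fun z w => by rw [h1, ha]⟩

/-- The interpolation nodes `1, …, k`. -/
def nodes (k : ℕ) (i : Fin k) : ℂ := (i : ℕ) + 1

theorem nodes_ne_zero {k : ℕ} (i : Fin k) : nodes k i ≠ 0 := Nat.cast_add_one_ne_zero _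

theorem nodes_injective (k : ℕ) : Function.Injective (nodes k) := fun i j hij => by
  have : ((i : ℕ) : ℂ) = (j : ℕ) := add_right_cancel hij
  exact Fin.ext (Nat.cast_injective this)

theorem coeff_eq_of_forall_sum_eq {k : ℕ} {a b : Fin k → ℂ}
    (hab : ∀ i, ∑ j, a j * nodes k i ^ (j : ℕ) = ∑ j, b j * nodes k i ^ (j : ℕ)) : a = b := by
  refine sub_eq_zero.1 (Matrix.eq_zero_of_forall_index_sum_pow_mul_eq_zero (nodes_injective k)
    fun i => ?_)
  have := sub_eq_zero.2 (hab i)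
  rw [← Finset.sum_sub_distrib] at this
  rw [← this]
  exact Finset.sum_congr rfl fun j _ => by rw [Pi.sub_apply]; ring

/-- The coefficients of a polynomial of degree less than `k` in terms of its values. -/
theorem exists_coeff_eq_sum (k : ℕ) : ∃ M : Matrix (Fin k) (Fin k) ℂ, ∀ a : Fin k → ℂ, ∀ j,
    a j = ∑ i, M j i * ∑ l, a l * nodes k i ^ (l : ℕ) := by
  have hdet : IsUnit (Matrix.vandermonde (nodes k)).det :=
    (Matrix.det_vandermonde_ne_zero_iff.2 (nodes_injective k)).isUnit
  refine ⟨(Matrix.vandermonde (nodes k))⁻¹, fun a j => ?_⟩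
  have h1 : (Matrix.vandermonde (nodes k)).mulVec a =
      fun i => ∑ l, a l * nodes k i ^ (l : ℕ) := by
    ext i
    simp only [Matrix.mulVec, dotProduct, Matrix.vandermonde_apply, mul_comm]
  have h2 : ((Matrix.vandermonde (nodes k))⁻¹).mulVec
      ((Matrix.vandermonde (nodes k)).mulVec a) = a := by
    rw [Matrix.mulVec_mulVec, Matrix.nonsing_inv_mul _ hdet, Matrix.one_mulVec]
  rw [h1] at h2
  exact (congrFun h2 j).symm

/-- An equivariant function is a polynomial in the second coordinate with coefficients in the
spaces `𝒵_{φ,ν}`. -/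
theorem IsEquivariantFun.exists_eq_sum_solutionSpace (h : IsExpanding lam mu φ) {c : ℂ}
    {U : ℂ × ℂ × ℝ → ℂ} (hU : IsEquivariantFun lam mu φ c U) (hc : ‖c‖ ≤ ‖(lam : ℂ)‖) {k : ℕ}
    (hk : ‖c‖ ≤ ‖(mu : ℂ)‖ ^ k) {ν : Fin k → ℂ} (hν : ∀ j, ν j * (mu : ℂ) ^ (j : ℕ) = c) :
    ∃ b : (j : Fin k) → solutionSpace φ (ν j), ∀ q : reebCover,
      U q.1 = ∑ j, (b j).1 (height q) * q.1.2.1 ^ (j : ℕ) := by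
  obtain ⟨M, hM⟩ := exists_coeff_eq_sum k
  have hex : ∀ x : ℝ≥0, ∃ a : Fin k → ℂ, ∀ z w : ℂ, (z, w, (x : ℝ)) ∈ reebCover →
      U (z, w, x) = ∑ j, a j * w ^ (j : ℕ) := by
    intro x
    rcases eq_or_ne x 0 with rfl | hx
    -- On the boundary the coefficients are zero because `U` vanishes there.
    · exact ⟨0, fun z w hzw => by rw [hU.eq_zero ⟨_, hzw⟩ (NNReal.eq rfl)]; simp⟩
    · obtain ⟨a, ha⟩ := hU.exists_eq_sum h hc hk (pos_iff_ne_zero.2 hx)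
      exact ⟨a, fun z w _ => ha z w⟩
  choose a ha using hex
  have hsm : ∀ j, SmoothOnHalfLine fun x => a x j := by
    intro j
    -- The inverse Vandermonde matrix expresses the coefficients through values of `U` at `(0, w,
    -- x)` with `w` a node. Since the nodes are nonzero, these points lie in `R̃` even for `x = 0`,
    -- which gives smoothness up to the boundary.
    have e : ∀ x : ℝ≥0, a x j = ∑ i, M j i * U (0, nodes k i, x) := fun x => by
      rw [hM (a x) j]
      exact Finset.sum_congr rfl fun i _ => by
        rw [ha x 0 (nodes k i) (mem_reebCover_of_ne_right x.2 _ (nodes_ne_zero i))]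
    simp only [SmoothOnHalfLine, e]
    refine ContDiffOn.sum fun i _ => contDiffOn_const.mul ?_
    have h2 : ContDiff ℝ ∞ fun x : ℝ => ((0, nodes k i, x) : ℂ × ℂ × ℝ) := by fun_prop
    refine (hU.contDiffOn.comp (s := Set.Ici 0) h2.contDiffOn fun x hx =>
      mem_reebCover_of_ne_right hx _ (nodes_ne_zero i)).congr fun x hx => ?_
    simp only [Function.comp_apply, Real.coe_toNNReal x hx]
  have heq : ∀ x : ℝ≥0, (fun j => a (φ.1 x) j * (mu : ℂ) ^ (j : ℕ)) = fun j => c * a x j := by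
    intro x
    refine coeff_eq_of_forall_sum_eq fun i => ?_
    have hm := mem_reebCover_of_ne_left x.2 (one_ne_zero (α := ℂ)) (nodes k i)
    have := hU.map_coverMap ⟨_, hm⟩
    have e0 : U (1, nodes k i, x) = _ := ha x _ _ hm
    change U (coverMap lam mu φ ⟨_, hm⟩).1 = c * U (1, nodes k i, x) at this
    rw [e0, Finset.mul_sum] at this
    have e : (coverMap lam mu φ ⟨_, hm⟩).1 =
        ((lam : ℂ) * 1, (mu : ℂ) * nodes k i, (φ.1 x : ℝ)) := rfl
    rw [e, ha (φ.1 x) _ _ (e ▸ (coverMap lam mu φ ⟨_, hm⟩).2)] at this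
    calc _ = ∑ j, a (φ.1 x) j * ((mu : ℂ) * nodes k i) ^ (j : ℕ) :=
          Finset.sum_congr rfl fun j _ => by ring
      _ = _ := this
      _ = _ := Finset.sum_congr rfl fun j _ => by ring
  refine ⟨fun j => ⟨fun x => a x j, hsm j, fun x => ?_⟩, fun q => ?_⟩
  · have hm : (mu : ℂ) ^ (j : ℕ) ≠ 0 := pow_ne_zero _ mu.ne_zero
    have : a (φ.1 x) j * (mu : ℂ) ^ (j : ℕ) = c * a x j := congrFun (heq x) j
    refine mul_right_cancel₀ hm ?_
    rw [this, ← hν j]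
    ring
  · exact ha (height q) q.1.1 q.1.2.1 q.2

/-- The lifts of the elements of the kernel of `P`. -/
theorem exists_relLift_eq_of_mem_ker (h : IsExpanding lam mu φ) {k : ℕ}
    (hk : ‖(lam : ℂ)‖ ≤ ‖(mu : ℂ)‖ ^ k) {ν : Fin k → ℂ}
    (hν : ∀ j, ν j * (mu : ℂ) ^ (j : ℕ) = lam) {f : autReebRel lam mu φ}
    (hf : f ∈ (heightHom h).ker) :
    ∃ (b : (j : Fin k) → solutionSpace φ (ν j)) (β : solutionSpace φ (mu : ℂ)),
      ∀ q, (relLift h f q).1 = (q.1.1 + ∑ j, (b j).1 (height q) * q.1.2.1 ^ (j : ℕ),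
        q.1.2.1 + β.1 (height q), q.1.2.2) := by
  have hg := isLeafwiseMap_relLift h f
  have hbd := (isRelLift_relLift h f).2.2
  have hd : ∀ x : ℝ, 0 < x → Differentiable ℂ fun z : ℂ × ℂ =>
      ((ambientExt (relLift h f) (z.1, z.2, x)).1, (ambientExt (relLift h f) (z.1, z.2, x)).2.1) := by
    intro x hx
    have := hg.differentiableOn x
    rwa [coverSlice_of_pos hx, differentiableOn_univ] at this
  -- The lift commutes with `T`, and `T` multiplies the first coordinate by `λ`, so the displacement
  -- in that coordinate is multiplied by `λ` as well; likewise with `μ` for the second.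
  have h1 : IsEquivariantFun lam mu φ lam
      (fun q => (ambientExt (relLift h f) q).1 - q.1) := by
    refine ⟨(contDiff_fst.comp_contDiffOn hg.contDiffOn).sub contDiff_fst.contDiffOn,
      fun q hq => ?_, fun x hx => (hd x hx).fst.sub differentiable_fst, fun q => ?_⟩
    · rw [ambientExt_apply, hbd q hq, sub_self]
    · rw [ambientExt_apply, ambientExt_apply, relLift_coverMap, mul_sub]
      rfl
  have h2 : IsEquivariantFun lam mu φ mu
      (fun q => (ambientExt (relLift h f) q).2.1 - q.2.1) := by
    refine ⟨((contDiff_fst.comp contDiff_snd).comp_contDiffOn hg.contDiffOn).sub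
      (contDiff_fst.comp contDiff_snd).contDiffOn,
      fun q hq => ?_, fun x hx => (hd x hx).snd.sub differentiable_snd, fun q => ?_⟩
    · rw [ambientExt_apply, hbd q hq, sub_self]
    · rw [ambientExt_apply, ambientExt_apply, relLift_coverMap, mul_sub]
      rfl
  obtain ⟨b, hb⟩ := h1.exists_eq_sum_solutionSpace h le_rfl hk hν
  -- With `c = μ` the bound holds already for `k = 1`, with equality, so the displacement is a
  -- function of `x` alone.
  obtain ⟨β, hβ⟩ := h2.exists_eq_sum_solutionSpace h h.mu_le_lam (k := 1) (by rw [pow_one])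
    (ν := fun _ => (mu : ℂ)) (fun j => by simp [Subsingleton.elim j 0])
  refine ⟨b, β 0, fun q => Prod.ext ?_ (Prod.ext ?_ ?_)⟩
  · rw [← hb q, ambientExt_apply]
    ring
  · have := hβ q
    simp only [ambientExt_apply, Finset.univ_unique, Finset.sum_singleton, Fin.default_eq_zero,
      Fin.val_zero, pow_zero, mul_one] at this
    change _ = q.1.2.1 + (β 0).1 (height q)
    rw [← this]
    ring
  · exact congrArg NNReal.toReal ((mem_ker_heightHom_iff h).1 hf q)

end Growth
end

/-! ### Triangular automorphisms -/

noncomputable section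

open Topology Filter

section Shear

/-- The map `(z₁, z₂, x) ↦ (z₁ + A z₂ x, z₂ + B x, x)` of `R̃` into itself. -/
def shear (A : ℂ → ℝ≥0 → ℂ) (B : ℝ≥0 → ℂ) (hA : ∀ w, A w 0 = 0) (hB : B 0 = 0)
    (q : reebCover) : reebCover :=
  ⟨(q.1.1 + A q.1.2.1 (height q), q.1.2.1 + B (height q), height q), q.2.1, fun h => by
    have hx : q.1.2.2 = 0 := congrArg (fun q : ℂ × ℂ × ℝ => q.2.2) h
    have h0 : height q = 0 := NNReal.eq hx
    rw [h0, hA, hB, add_zero, add_zero] at h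
    have h1 : q.1.1 = 0 := congrArg (fun q : ℂ × ℂ × ℝ => q.1) h
    have h2 : q.1.2.1 = 0 := congrArg (fun q : ℂ × ℂ × ℝ => q.2.1) h
    exact q.2.2 (Prod.ext h1 (Prod.ext h2 hx))⟩

theorem height_shear {A : ℂ → ℝ≥0 → ℂ} {B : ℝ≥0 → ℂ} (hA : ∀ w, A w 0 = 0) (hB : B 0 = 0)
    (q : reebCover) : height (shear A B hA hB q) = height q := NNReal.eq rfl

/-- A shear as a permutation of `R̃`. -/
def shearPerm (A : ℂ → ℝ≥0 → ℂ) (B : ℝ≥0 → ℂ) (hA : ∀ w, A w 0 = 0) (hB : B 0 = 0) :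
    Equiv.Perm reebCover where
  toFun := shear A B hA hB
  -- The shift of the second coordinate is undone inside `A`, so that `A` is evaluated at the
  -- original second coordinate.
  invFun := shear (fun w x => -A (w - B x) x) (fun x => -B x) (by simp [hA]) (by simp [hB])
  left_inv q := by
    refine Subtype.ext (Prod.ext ?_ (Prod.ext ?_ rfl))
    · change q.1.1 + A q.1.2.1 (height q) +
        -A (q.1.2.1 + B (height q) - B (height q)) (height q) = q.1.1
      ring_nf
    · change q.1.2.1 + B (height q) + -B (height q) = q.1.2.1
      ring
  right_inv q := by
    refine Subtype.ext (Prod.ext ?_ (Prod.ext ?_ rfl))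
    · change q.1.1 + -A (q.1.2.1 - B (height q)) (height q) +
        A (q.1.2.1 + -B (height q)) (height q) = q.1.1
      ring_nf
    · change q.1.2.1 + -B (height q) + B (height q) = q.1.2.1
      ring

theorem SmoothOnHalfLine.comp_snd_snd {B : ℝ≥0 → ℂ} (hB : SmoothOnHalfLine B) :
    ContDiffOn ℝ ∞ (fun q : ℂ × ℂ × ℝ => B q.2.2.toNNReal) {q | 0 ≤ q.2.2} :=
  ContDiffOn.comp (t := Set.Ici 0) (g := fun x : ℝ => B x.toNNReal) hB
    (contDiff_snd.comp contDiff_snd).contDiffOn fun _ hp => hp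

theorem isLeafwiseMap_shear {A : ℂ → ℝ≥0 → ℂ} {B : ℝ≥0 → ℂ} (hA : ∀ w, A w 0 = 0)
    (hB : B 0 = 0)
    (hAs : ContDiffOn ℝ ∞ (fun q : ℂ × ℂ × ℝ => A q.2.1 q.2.2.toNNReal) {q | 0 ≤ q.2.2})
    (hAd : ∀ x, Differentiable ℂ fun w => A w x) (hBs : SmoothOnHalfLine B) :
    IsLeafwiseMap (shear A B hA hB) := by
  have e : ∀ q ∈ reebCover, ambientExt (shear A B hA hB) q =
      (q.1 + A q.2.1 q.2.2.toNNReal, q.2.1 + B q.2.2.toNNReal, q.2.2) := by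
    intro q hq
    rw [ambientExt_of_mem _ hq]
    have : q.2.2.toNNReal = height ⟨q, hq⟩ := NNReal.eq (Real.coe_toNNReal _ hq.1)
    rw [this]
    rfl
  have hsub : reebCover ⊆ {q : ℂ × ℂ × ℝ | 0 ≤ q.2.2} := fun q hq => hq.1
  refine ⟨?_, fun q r hqr => ?_, fun x => ?_⟩
  · exact ((contDiff_fst.contDiffOn.add (hAs.mono hsub)).prodMk
      (((contDiff_fst.comp contDiff_snd).contDiffOn.add (hBs.comp_snd_snd.mono hsub)).prodMk
        (contDiff_snd.comp contDiff_snd).contDiffOn)).congr e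
  · rw [height_shear, height_shear, hqr]
  · have hd : Differentiable ℂ fun z : ℂ × ℂ =>
        (z.1 + A z.2 x.toNNReal, z.2 + B x.toNNReal) :=
      (differentiable_fst.add ((hAd _).comp differentiable_snd)).prodMk
        (differentiable_snd.add_const _)
    refine hd.differentiableOn.congr fun z hz => ?_
    simp only [e _ hz]

variable {lam mu : ℂˣ} {φ : DiffHalfLine}

/-- Since `φ` fixes `0`, the equation there reads `β(0) = ν β(0)`. This makes the shears the
identity on the boundary. -/
theorem solutionSpace.apply_zero {ν : ℂ} (hν : ν ≠ 1) (b : solutionSpace φ ν) : b.1 0 = 0 := by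
  have h := b.2.2 0
  rw [DiffHalfLine.apply_zero] at h
  have h' : (ν - 1) * b.1 0 = 0 := by rw [sub_mul, one_mul, ← h, sub_self]
  exact (mul_eq_zero.1 h').resolve_left (sub_ne_zero.2 hν)

theorem IsExpanding.mu_ne_one (h : IsExpanding lam mu φ) : (mu : ℂ) ≠ 1 := fun h1 => by
  simpa [h1] using h.one_lt_mu

/-- The relation `ν_j μ ^ j = λ` is what makes the term `β_j(x) z₂ ^ j` scale by `λ` under `T`,
hence makes the shear commute with `T`. -/
theorem exists_relLift_eq_shear (h : IsExpanding lam mu φ) {k : ℕ} {ν : Fin k → ℂ}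
    (hν : ∀ j, ν j * (mu : ℂ) ^ (j : ℕ) = lam) (hν1 : ∀ j, ν j ≠ 1)
    (b : (j : Fin k) → solutionSpace φ (ν j)) (β : solutionSpace φ (mu : ℂ)) :
    ∃ f : (heightHom h).ker, ∀ q, (relLift h f.1 q).1 =
      (q.1.1 + ∑ j, (b j).1 (height q) * q.1.2.1 ^ (j : ℕ),
        q.1.2.1 + β.1 (height q), q.1.2.2) := by
  have hA : ∀ w : ℂ, ∑ j, (b j).1 0 * w ^ (j : ℕ) = 0 := fun w =>
    Finset.sum_eq_zero fun j _ => by rw [solutionSpace.apply_zero (hν1 j), zero_mul]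
  have hB : β.1 0 = 0 := solutionSpace.apply_zero h.mu_ne_one β
  have hw : ContDiff ℝ ∞ fun q : ℂ × ℂ × ℝ => q.2.1 := contDiff_fst.comp contDiff_snd
  have hβ := β.2.1.comp_snd_snd
  have hm : IsLeafwiseMap
      (shearPerm (fun w x => ∑ j, (b j).1 x * w ^ (j : ℕ)) β.1 hA hB) := by
    refine isLeafwiseMap_shear (A := fun w x => ∑ j, (b j).1 x * w ^ (j : ℕ)) hA hB ?_ (fun x => ?_) β.2.1
    · refine ContDiffOn.sum fun j _ => ?_
      exact (b j).2.1.comp_snd_snd.mul (hw.contDiffOn.pow _)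
    · fun_prop
  have hm' : IsLeafwiseMap
      (shearPerm (fun w x => ∑ j, (b j).1 x * w ^ (j : ℕ)) β.1 hA hB).symm := by
    refine isLeafwiseMap_shear (A := fun w x => -∑ j, (b j).1 x * (w - β.1 x) ^ (j : ℕ))
      (B := fun x => -β.1 x)
      (fun w => by rw [hA, neg_zero]) (by rw [hB, neg_zero]) ?_ (fun x => ?_) (ContDiffOn.neg β.2.1)
    · refine ContDiffOn.neg (ContDiffOn.sum fun j _ => ?_)
      exact (b j).2.1.comp_snd_snd.mul ((hw.contDiffOn.sub hβ).pow _)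
    · fun_prop
  have hT : ∀ q, shearPerm (fun w x => ∑ j, (b j).1 x * w ^ (j : ℕ)) β.1 hA hB
      (coverMap lam mu φ q) = coverMap lam mu φ
        (shearPerm (fun w x => ∑ j, (b j).1 x * w ^ (j : ℕ)) β.1 hA hB q) := by
    intro q
    refine Subtype.ext (Prod.ext ?_ (Prod.ext ?_ ?_))
    · change (lam : ℂ) * q.1.1 + ∑ j, (b j).1 (φ.1 (height q)) * ((mu : ℂ) * q.1.2.1) ^ (j : ℕ) =
        lam * (q.1.1 + ∑ j, (b j).1 (height q) * q.1.2.1 ^ (j : ℕ))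
      rw [mul_add, Finset.mul_sum]
      congr 1
      refine Finset.sum_congr rfl fun j _ => ?_
      rw [(b j).2.2, ← hν j]
      ring
    · change (mu : ℂ) * q.1.2.1 + β.1 (φ.1 (height q)) = mu * (q.1.2.1 + β.1 (height q))
      rw [β.2.2, mul_add]
    · change (φ.1 (height q) : ℝ) = φ.1 (height (shear _ _ hA hB q))
      rw [height_shear]
  obtain ⟨f, hf⟩ := exists_relLift_eq h _ hm hm' hT (fun q hq => by
    refine Subtype.ext (Prod.ext ?_ (Prod.ext ?_ rfl))
    · change q.1.1 + ∑ j, (b j).1 (height q) * q.1.2.1 ^ (j : ℕ) = q.1.1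
      rw [hq, hA, add_zero]
    · change q.1.2.1 + β.1 (height q) = q.1.2.1
      rw [hq, hB, add_zero])
  refine ⟨⟨f, (mem_ker_heightHom_iff h).2 fun q => ?_⟩, fun q => ?_⟩
  · rw [hf]
    exact height_shear hA hB q
  · change (relLift h f q).1 = _
    rw [hf]
    rfl

end Shear

/-! ### The group extension describing the kernel -/

section Extension

variable {lam mu : ℂˣ} {φ : DiffHalfLine}

theorem exists_second_coordinate (h : IsExpanding lam mu φ) (f : (heightHom h).ker) :
    ∃ β : solutionSpace φ (mu : ℂ), ∀ q,
      (relLift h f.1 q).1.2.1 = q.1.2.1 + β.1 (height q) := by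
  -- Any degree bound will do, since the polynomial in the first coordinate is discarded.
  obtain ⟨k, hk⟩ := ((tendsto_pow_atTop_atTop_of_one_lt h.one_lt_mu).eventually_ge_atTop
    ‖(lam : ℂ)‖).exists
  obtain ⟨b, β, hβ⟩ := exists_relLift_eq_of_mem_ker h hk
    (ν := fun j => lam * ((mu : ℂ) ^ (j : ℕ))⁻¹)
    (fun j => by rw [inv_mul_cancel_right₀ (pow_ne_zero _ mu.ne_zero)]) f.2
  exact ⟨β, fun q => by rw [hβ q]⟩

/-- The function `β₂` of an element of the kernel of `P`. -/
def secondCoordinate (h : IsExpanding lam mu φ) (f : (heightHom h).ker) :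
    solutionSpace φ (mu : ℂ) := (exists_second_coordinate h f).choose

theorem relLift_secondCoordinate (h : IsExpanding lam mu φ) (f : (heightHom h).ker)
    (q : reebCover) : (relLift h f.1 q).1.2.1 = q.1.2.1 + (secondCoordinate h f).1 (height q) :=
  (exists_second_coordinate h f).choose_spec q

theorem eq_secondCoordinate (h : IsExpanding lam mu φ) {f : (heightHom h).ker}
    {β : solutionSpace φ (mu : ℂ)}
    (hβ : ∀ q, (relLift h f.1 q).1.2.1 = q.1.2.1 + β.1 (height q)) :
    secondCoordinate h f = β := by
  refine Subtype.ext (funext fun x => ?_)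
  have := (relLift_secondCoordinate h f (basePoint x)).symm.trans (hβ (basePoint x))
  rw [height_basePoint] at this
  exact add_left_cancel this

/-- The homomorphism `ker P → 𝒵_{φ,μ}`. -/
def secondCoordinateHom (h : IsExpanding lam mu φ) :
    (heightHom h).ker →* Multiplicative (solutionSpace φ (mu : ℂ)) where
  toFun f := Multiplicative.ofAdd (secondCoordinate h f)
  map_one' := congrArg Multiplicative.ofAdd (eq_secondCoordinate h (β := 0) fun q => by
    change (relLift h 1 q).1.2.1 = q.1.2.1 + 0
    rw [relLift_one, add_zero]
    rfl)
  map_mul' f f' := by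
    rw [← ofAdd_add]
    refine congrArg Multiplicative.ofAdd (eq_secondCoordinate h fun q => ?_)
    change (relLift h (f.1 * f'.1) q).1.2.1 =
      q.1.2.1 + ((secondCoordinate h f).1 (height q) + (secondCoordinate h f').1 (height q))
    rw [relLift_mul, Function.comp_apply, relLift_secondCoordinate, relLift_secondCoordinate,
      (mem_ker_heightHom_iff h).1 f'.2]
    ring

variable {k : ℕ} {ν : Fin k → ℂ}

/-- The automorphism with the lift `(z₁, z₂, x) ↦ (z₁ + ∑ j, β_j(x) z₂ ^ j, z₂, x)`. -/
def polyShear (h : IsExpanding lam mu φ) (hν : ∀ j, ν j * (mu : ℂ) ^ (j : ℕ) = lam)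
    (hν1 : ∀ j, ν j ≠ 1) (b : (j : Fin k) → solutionSpace φ (ν j)) : (heightHom h).ker :=
  (exists_relLift_eq_shear h hν hν1 b 0).choose

theorem relLift_polyShear (h : IsExpanding lam mu φ)
    (hν : ∀ j, ν j * (mu : ℂ) ^ (j : ℕ) = lam) (hν1 : ∀ j, ν j ≠ 1)
    (b : (j : Fin k) → solutionSpace φ (ν j)) (q : reebCover) :
    (relLift h (polyShear h hν hν1 b).1 q).1 =
      (q.1.1 + ∑ j, (b j).1 (height q) * q.1.2.1 ^ (j : ℕ), q.1.2.1, q.1.2.2) := by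
  refine ((exists_relLift_eq_shear h hν hν1 b 0).choose_spec q).trans ?_
  simp

theorem eq_polyShear (h : IsExpanding lam mu φ)
    (hν : ∀ j, ν j * (mu : ℂ) ^ (j : ℕ) = lam) (hν1 : ∀ j, ν j ≠ 1)
    {b : (j : Fin k) → solutionSpace φ (ν j)} {f : (heightHom h).ker}
    (hf : ∀ q, (relLift h f.1 q).1 =
      (q.1.1 + ∑ j, (b j).1 (height q) * q.1.2.1 ^ (j : ℕ), q.1.2.1, q.1.2.2)) :
    polyShear h hν hν1 b = f := by
  refine Subtype.ext (relLift_injective h (funext fun q => Subtype.ext ?_))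
  rw [relLift_polyShear, hf]

/-- The homomorphism from the product of the spaces `𝒵_{φ,ν}` into `ker P`. -/
def polyShearHom (h : IsExpanding lam mu φ) (hν : ∀ j, ν j * (mu : ℂ) ^ (j : ℕ) = lam)
    (hν1 : ∀ j, ν j ≠ 1) :
    Multiplicative ((j : Fin k) → solutionSpace φ (ν j)) →* (heightHom h).ker where
  toFun b := polyShear h hν hν1 b.toAdd
  map_one' := eq_polyShear h hν hν1 fun q => by
    change (relLift h 1 q).1 = _
    rw [relLift_one]
    simp
  map_mul' b b' := eq_polyShear h hν hν1 fun q => by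
    have hh := (mem_ker_heightHom_iff h).1 (polyShear h hν hν1 b'.toAdd).2 q
    change (relLift h ((polyShear h hν hν1 b.toAdd).1 * (polyShear h hν hν1 b'.toAdd).1) q).1 = _
    -- The inner shear changes neither `z₂` nor `x`, so the outer one adds its own polynomial at the
    -- same arguments.
    rw [relLift_mul, Function.comp_apply, relLift_polyShear, hh, relLift_polyShear]
    simp only [toAdd_mul, Pi.add_apply, Submodule.coe_add, add_mul, Finset.sum_add_distrib]
    refine Prod.ext ?_ rfl
    change q.1.1 + _ + _ = q.1.1 + (_ + _)
    ring

/-- At fixed `x` the lift determines the polynomial in `z₂` at the nodes, hence its coefficients. -/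
theorem polyShearHom_injective (h : IsExpanding lam mu φ)
    (hν : ∀ j, ν j * (mu : ℂ) ^ (j : ℕ) = lam) (hν1 : ∀ j, ν j ≠ 1) :
    Function.Injective (polyShearHom h hν hν1) := by
  intro b b' hbb
  refine Multiplicative.toAdd.injective (funext fun j => Subtype.ext (funext fun x => ?_))
  refine congrFun (coeff_eq_of_forall_sum_eq (a := fun j => (b.toAdd j).1 x)
    (b := fun j => (b'.toAdd j).1 x) fun i => ?_) j
  let q : reebCover := ⟨(0, nodes k i, x), mem_reebCover_of_ne_right x.2 _ (nodes_ne_zero i)⟩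
  have hq : height q = x := NNReal.eq rfl
  have h1 : polyShear h hν hν1 b.toAdd = polyShear h hν hν1 b'.toAdd := hbb
  have h2 := relLift_polyShear h hν hν1 b.toAdd q
  rw [h1, relLift_polyShear, hq] at h2
  exact (add_left_cancel (congrArg Prod.fst h2)).symm

/-- The structure of the kernel of `P`. -/
theorem exists_groupExtension (h : IsExpanding lam mu φ)
    (hν : ∀ j, ν j * (mu : ℂ) ^ (j : ℕ) = lam) (hν1 : ∀ j, ν j ≠ 1)
    (hk : ‖(lam : ℂ)‖ ≤ ‖(mu : ℂ)‖ ^ k) :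
    ∃ S : GroupExtension (Multiplicative ((j : Fin k) → solutionSpace φ (ν j)))
        (heightHom h).ker (Multiplicative (solutionSpace φ (mu : ℂ))),
      (∀ b : (j : Fin k) → solutionSpace φ (ν j), ∀ g : reebCover → reebCover,
        IsRelLift lam mu φ (⇑(S.inl (Multiplicative.ofAdd b)).1.1) g →
        ∀ q, (g q).1 =
          (q.1.1 + ∑ j, (b j).1 (height q) * q.1.2.1 ^ (j : ℕ), q.1.2.1, q.1.2.2)) ∧
      (∀ f : (heightHom h).ker, ∀ g : reebCover → reebCover,
        IsRelLift lam mu φ (⇑f.1.1) g →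
        ∀ q, (g q).1.2.1 = q.1.2.1 + (S.rightHom f).toAdd.1 (height q)) := by
  refine ⟨⟨polyShearHom h hν hν1, secondCoordinateHom h, polyShearHom_injective h hν hν1,
    ?_, fun β => ?_⟩, fun b g hg q => ?_, fun f g hg q => ?_⟩
  · ext f
    rw [MonoidHom.mem_range, MonoidHom.mem_ker]
    constructor
    · rintro ⟨b, rfl⟩
      refine congrArg Multiplicative.ofAdd (eq_secondCoordinate h (β := 0) fun q => ?_)
      change (relLift h (polyShear h hν hν1 b.toAdd).1 q).1.2.1 = q.1.2.1 + 0
      rw [relLift_polyShear, add_zero]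
    · intro hf
      obtain ⟨b, β, hb⟩ := exists_relLift_eq_of_mem_ker h hk hν f.2
      have h0 : secondCoordinate h f = 0 := hf
      have hβ : β = 0 := by
        rw [← h0]
        exact (eq_secondCoordinate h fun q => by rw [hb q]).symm
      refine ⟨Multiplicative.ofAdd b, eq_polyShear h hν hν1 fun q => ?_⟩
      rw [hb q, hβ]
      simp
  · obtain ⟨f, hf⟩ := exists_relLift_eq_shear h hν hν1 0 β.toAdd
    exact ⟨f, congrArg Multiplicative.ofAdd (eq_secondCoordinate h (β := β.toAdd) fun q => by
      rw [hf q])⟩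
  · rw [eq_relLift h hg]
    exact relLift_polyShear h hν hν1 b q
  · rw [eq_relLift h hg]
    exact relLift_secondCoordinate h f q

end Extension
end

/-! ### Extension of solutions to the boundary point -/

noncomputable section

open Topology Filter Set

section Extend

theorem DiffHalfLine.strictMono (φ : DiffHalfLine) : StrictMono φ.1 := by
  rcases (DiffHalfLine.continuous φ).strictMono_of_inj φ.1.injective with h | h
  · exact h
  · have := h (zero_lt_one (α := ℝ≥0))
    rw [DiffHalfLine.apply_zero] at this
    exact absurd this not_lt_zero

/-- A nonnegative function which is contracted, up to small errors, by the expanding dynamics of `φ`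
tends to zero. -/
theorem tendsto_zero_of_le_mul_comp {φ : DiffHalfLine} (hφ : ∀ x : ℝ≥0, 0 < x → x < φ.1 x)
    {G : ℝ≥0 → ℝ} (hG0 : ∀ x, 0 ≤ G x) (hG : ContinuousOn G (Ioi 0)) {θ : ℝ} (hθ0 : 0 < θ)
    (hθ : θ < 1) (hle : ∀ ε > 0, ∀ᶠ x in 𝓝[>] 0, G x ≤ θ * (G (φ.1 x) + ε)) :
    Tendsto G (𝓝[>] 0) (𝓝 0) := by
  -- The constant `ε θ / (1 - θ)` is the fixed point of `t ↦ θ (t + ε)`. Above it, each step towards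
  -- `0` contracts the bound by `θ`.
  have key : ∀ ε > 0, ∃ M : ℝ, ∃ x₀ : ℝ≥0, 0 < x₀ ∧
      ∀ n : ℕ, ∀ x, 0 < x → x ≤ φ.1.symm^[n] x₀ → G x ≤ θ ^ n * M + ε * (θ / (1 - θ)) := by
    intro ε hε
    obtain ⟨x₀, hx₀, hx₀'⟩ := mem_nhdsGT_iff_exists_Ioc_subset.1 (hle ε hε)
    replace hx₀ : 0 < x₀ := hx₀
    have hpos : ∀ m, 0 < φ.1.symm^[m] x₀ := fun m => by
      induction m with
      | zero => exact hx₀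
      | succ m ih =>
        rw [Function.iterate_succ_apply']
        exact DiffHalfLine.pos_of_pos φ⁻¹ ih
    have hs1 : φ.1.symm x₀ ≤ x₀ := by
      simpa using (hφ _ (hpos 1)).le
    have hsle : ∀ n, φ.1.symm^[n] x₀ ≤ x₀ := by
      intro n
      induction n with
      | zero => exact le_rfl
      | succ n ih =>
        rw [Function.iterate_succ_apply']
        exact ((DiffHalfLine.strictMono φ⁻¹).monotone ih).trans hs1
    -- The interval `[φ⁻¹ x₀, x₀]` is a fundamental domain; its bound `M` is carried towards `0` by
    -- the inequality, first as a uniform bound (`hbase`), then with the factor `θ ^ n`.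
    obtain ⟨M, hM⟩ := (isCompact_Icc (a := φ.1.symm x₀) (b := x₀)).exists_bound_of_continuousOn
      (hG.mono fun x hx => (hpos 1).trans_le hx.1)
    have hM' : ∀ x, φ.1.symm x₀ ≤ x → x ≤ x₀ → G x ≤ M := fun x h1 h2 =>
      (le_abs_self _).trans (hM x ⟨h1, h2⟩)
    have hM0 : 0 ≤ M := (hG0 _).trans (hM' x₀ hs1 le_rfl)
    have h1θ : 0 < 1 - θ := sub_pos.2 hθ
    have hfix : θ * (ε * (θ / (1 - θ)) + ε) = ε * (θ / (1 - θ)) := by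
      field_simp
      ring
    have hK : 0 ≤ ε * (θ / (1 - θ)) := by positivity
    have hstep : ∀ x A, 0 < x → x ≤ x₀ → G (φ.1 x) ≤ A + ε * (θ / (1 - θ)) →
        G x ≤ θ * A + ε * (θ / (1 - θ)) := by
      intro x A h0 h1 h2
      have h3 : G x ≤ θ * (G (φ.1 x) + ε) := hx₀' ⟨h0, h1⟩
      have h4 : θ * (G (φ.1 x) + ε) ≤ θ * (A + ε * (θ / (1 - θ)) + ε) := by gcongr
      linarith [mul_add θ A (ε * (θ / (1 - θ)) + ε)]
    have hbase : ∀ m : ℕ, ∀ x, φ.1.symm^[m] x₀ ≤ x → x ≤ x₀ →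
        G x ≤ M + ε * (θ / (1 - θ)) := by
      intro m
      induction m with
      | zero =>
        intro x h1 h2
        obtain rfl : x = x₀ := le_antisymm h2 h1
        linarith [hM' x hs1 le_rfl]
      | succ m ih =>
        intro x h1 h2
        rcases le_total (φ.1.symm x₀) x with h3 | h3
        · linarith [hM' x h3 h2]
        · have h4 := ih (φ.1 x) (by
            rw [Function.iterate_succ_apply'] at h1
            simpa using (DiffHalfLine.strictMono φ).monotone h1) (by
            simpa using (DiffHalfLine.strictMono φ).monotone h3)
          have := hstep x M ((hpos _).trans_le h1) h2 h4
          nlinarith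
    refine ⟨M, x₀, hx₀, fun n => ?_⟩
    induction n with
    | zero =>
      intro x h1 h2
      obtain ⟨m, hm⟩ := ((tendsto_symm_iterate hφ x₀).eventually_le_const h1).exists
      rw [pow_zero, one_mul]
      exact hbase m x hm h2
    | succ n ih =>
      intro x h1 h2
      rw [pow_succ', mul_assoc]
      refine hstep x _ h1 (h2.trans (hsle _)) (ih _ (DiffHalfLine.pos_of_pos φ h1) ?_)
      rw [Function.iterate_succ_apply'] at h2
      simpa using (DiffHalfLine.strictMono φ).monotone h2
  rw [Metric.tendsto_nhds]
  intro δ hδ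
  have h1θ : 0 < 1 - θ := sub_pos.2 hθ
  obtain ⟨M, x₀, hx₀, hM⟩ := key (δ / 2 / (θ / (1 - θ))) (by positivity)
  have hlim : Tendsto (fun n : ℕ => θ ^ n * M) atTop (𝓝 0) := by
    simpa using (tendsto_pow_atTop_nhds_zero_of_lt_one hθ0.le hθ).mul_const M
  obtain ⟨n, hn⟩ := (hlim.eventually_lt_const (half_pos hδ)).exists
  have hpos : 0 < φ.1.symm^[n] x₀ := by
    clear hn
    induction n with
    | zero => exact hx₀
    | succ m ih =>
      rw [Function.iterate_succ_apply']
      exact DiffHalfLine.pos_of_pos φ⁻¹ ih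
  filter_upwards [Ioc_mem_nhdsGT hpos] with x hx
  have := hM n x hx.1 hx.2
  rw [div_mul_cancel₀ _ (by positivity)] at this
  rw [Real.dist_eq, sub_zero, abs_of_nonneg (hG0 x)]
  linarith

/-- The representation of a diffeomorphism of `[0, ∞)` as a function on `ℝ`. -/
def DiffHalfLine.toReal (φ : DiffHalfLine) (x : ℝ) : ℝ := φ.1 x.toNNReal

theorem DiffHalfLine.toReal_coe (φ : DiffHalfLine) (x : ℝ≥0) :
    DiffHalfLine.toReal φ x = φ.1 x := by
  rw [DiffHalfLine.toReal, Real.toNNReal_coe]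

theorem DiffHalfLine.toReal_pos (φ : DiffHalfLine) {x : ℝ} (hx : 0 < x) :
    0 < DiffHalfLine.toReal φ x :=
  NNReal.coe_pos.2 (DiffHalfLine.pos_of_pos φ (Real.toNNReal_pos.2 hx))

theorem DiffHalfLine.contDiffOn_toReal (φ : DiffHalfLine) :
    ContDiffOn ℝ ∞ (DiffHalfLine.toReal φ) (Ici 0) := φ.2.1

theorem ContDiffOn.derivWithin_Ici {E : Type*} [NormedAddCommGroup E] [NormedSpace ℝ E]
    {m : ℝ → E} (hm : ContDiffOn ℝ ∞ m (Ici 0)) :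
    ContDiffOn ℝ ∞ (derivWithin m (Ici 0)) (Ici 0) :=
  ((contDiffOn_infty_iff_derivWithin (uniqueDiffOn_Ici 0)).1 hm).2

theorem ContDiffOn.hasDerivAt_of_pos {E : Type*} [NormedAddCommGroup E] [NormedSpace ℝ E]
    {m : ℝ → E} (hm : ContDiffOn ℝ ∞ m (Ici 0)) {x : ℝ} (hx : 0 < x) :
    HasDerivAt m (derivWithin m (Ici 0) x) x :=
  ((hm.differentiableOn (by simp)) x hx.le).hasDerivWithinAt.hasDerivAt (Ici_mem_nhds hx)

/-- The chain rule for `φ⁻¹ ∘ φ = id`, one-sided at `0`. -/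
theorem DiffHalfLine.derivWithin_ne_zero (φ : DiffHalfLine) {x : ℝ} (hx : 0 ≤ x) :
    derivWithin (DiffHalfLine.toReal φ) (Ici 0) x ≠ 0 := by
  have h1 := ((DiffHalfLine.contDiffOn_toReal φ).differentiableOn (by simp) x hx).hasDerivWithinAt
  have h2 := ((DiffHalfLine.contDiffOn_toReal φ⁻¹).differentiableOn (by simp)
    (DiffHalfLine.toReal φ x) (NNReal.coe_nonneg _)).hasDerivWithinAt
  have h3 := h2.comp x h1 fun y _ => NNReal.coe_nonneg _
  have h4 : HasDerivWithinAt (DiffHalfLine.toReal φ⁻¹ ∘ DiffHalfLine.toReal φ) 1 (Ici 0) x := by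
    have e : ∀ y ∈ Ici (0 : ℝ), (DiffHalfLine.toReal φ⁻¹ ∘ DiffHalfLine.toReal φ) y = y := by
      intro y hy
      simp only [Function.comp_apply, DiffHalfLine.toReal, Real.toNNReal_coe]
      change ((φ.1.symm (φ.1 y.toNNReal) : ℝ≥0) : ℝ) = y
      rw [Equiv.symm_apply_apply, Real.coe_toNNReal y hy]
    exact (hasDerivWithinAt_id x _).congr e (e x hx)
  intro h0
  rw [h0, mul_zero] at h3
  exact zero_ne_one ((uniqueDiffOn_Ici (0 : ℝ) x hx).eq_deriv _ h3 h4)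

theorem InfinitelyTangentToId.derivWithin_zero {φ : DiffHalfLine}
    (hφ : InfinitelyTangentToId φ) : derivWithin (DiffHalfLine.toReal φ) (Ici 0) 0 = 1 := by
  have h1 : derivWithin (fun x => DiffHalfLine.toReal φ x - x) (Ici 0) 0 = 0 := by
    rw [← iteratedDerivWithin_one]
    exact hφ 1
  have hd : DifferentiableWithinAt ℝ (DiffHalfLine.toReal φ) (Ici 0) 0 :=
    (DiffHalfLine.contDiffOn_toReal φ).differentiableOn (by simp) 0 (self_mem_Ici (a := (0 : ℝ)))
  have hu : UniqueDiffWithinAt ℝ (Ici (0 : ℝ)) 0 := uniqueDiffOn_Ici 0 0 self_mem_Ici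
  have h2 := (hd.hasDerivWithinAt.sub (hasDerivWithinAt_id 0 (Ici 0))).derivWithin hu
  have h3 := h2.symm.trans h1
  linarith

/-- The derivatives of order at most `k` of `g` tend to zero at `0` from the right. -/
def FlatAtZero : ℕ → (ℝ → ℂ) → Prop
  | 0, g => Tendsto g (𝓝[>] 0) (𝓝 0)
  | k + 1, g => Tendsto g (𝓝[>] 0) (𝓝 0) ∧ FlatAtZero k (deriv g)

theorem FlatAtZero.of_succ {k : ℕ} : ∀ {g : ℝ → ℂ}, FlatAtZero (k + 1) g → FlatAtZero k g := by
  induction k with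
  | zero => exact fun hg => hg.1
  | succ k ih => exact fun hg => ⟨hg.1, ih hg.2⟩

theorem FlatAtZero.congr {k : ℕ} : ∀ {g g' : ℝ → ℂ}, FlatAtZero k g → EqOn g' g (Ioi 0) →
    FlatAtZero k g' := by
  induction k with
  | zero =>
    exact fun hg he => Tendsto.congr' (by
      filter_upwards [self_mem_nhdsWithin] with x hx using (he hx).symm) hg
  | succ k ih =>
    refine fun hg he => ⟨Tendsto.congr' (by
      filter_upwards [self_mem_nhdsWithin] with x hx using (he hx).symm) hg.1, ih hg.2 ?_⟩
    exact he.deriv isOpen_Ioi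

theorem ContDiffOn.deriv_Ioi {g : ℝ → ℂ} (hg : ContDiffOn ℝ ∞ g (Ioi 0)) :
    ContDiffOn ℝ ∞ (deriv g) (Ioi 0) :=
  ((contDiffOn_infty_iff_deriv_of_isOpen isOpen_Ioi).1 hg).2

theorem ContDiffOn.hasDerivAt_Ioi {g : ℝ → ℂ} (hg : ContDiffOn ℝ ∞ g (Ioi 0)) {x : ℝ}
    (hx : 0 < x) : HasDerivAt g (deriv g x) x :=
  ((hg.differentiableOn (by simp)) x hx |>.differentiableAt (Ioi_mem_nhds hx)).hasDerivAt

theorem FlatAtZero.add {k : ℕ} : ∀ {g g' : ℝ → ℂ}, ContDiffOn ℝ ∞ g (Ioi 0) →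
    ContDiffOn ℝ ∞ g' (Ioi 0) → FlatAtZero k g → FlatAtZero k g' →
    FlatAtZero k (fun x => g x + g' x) := by
  induction k with
  | zero => exact fun _ _ h h' => by simpa [FlatAtZero] using Tendsto.add h h'
  | succ k ih =>
    refine fun hs hs' h h' => ⟨by simpa using h.1.add h'.1,
      (ih hs.deriv_Ioi hs'.deriv_Ioi h.2 h'.2).congr fun x hx => ?_⟩
    exact ((hs.hasDerivAt_Ioi hx).add (hs'.hasDerivAt_Ioi hx)).deriv

/-- A factor smooth up to `0` has a finite limit there, as do its derivatives. In the product rule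
the term with the derivative of `m` only needs flatness of `g` to the lower order. -/
theorem FlatAtZero.mul {k : ℕ} : ∀ {m g : ℝ → ℂ}, ContDiffOn ℝ ∞ m (Ici 0) →
    ContDiffOn ℝ ∞ g (Ioi 0) → FlatAtZero k g → FlatAtZero k (fun x => m x * g x) := by
  have hlim : ∀ {m g : ℝ → ℂ}, ContDiffOn ℝ ∞ m (Ici 0) → Tendsto g (𝓝[>] 0) (𝓝 0) →
      Tendsto (fun x => m x * g x) (𝓝[>] 0) (𝓝 0) := by
    intro m g hm hg
    have h1 : Tendsto m (𝓝[>] 0) (𝓝 (m 0)) :=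
      (hm.continuousOn 0 self_mem_Ici).mono Ioi_subset_Ici_self
    simpa using h1.mul hg
  induction k with
  | zero => exact fun hm _ h => hlim hm h
  | succ k ih =>
    refine fun {m g} hm hs h => ⟨hlim hm h.1, ?_⟩
    refine (FlatAtZero.add ((hm.derivWithin_Ici.mono Ioi_subset_Ici_self).mul hs)
      ((hm.mono Ioi_subset_Ici_self).mul hs.deriv_Ioi) (ih hm.derivWithin_Ici hs h.of_succ)
      (ih hm hs.deriv_Ioi h.2)).congr fun x hx => ?_
    exact ((hm.hasDerivAt_of_pos hx).mul (hs.hasDerivAt_Ioi hx)).deriv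

/-- Near `0` one has `|a| > ρ > 1`, so solving the equation for `g x` gives a contraction with
factor `ρ⁻¹` and an error from `h`, which tends to zero. -/
theorem tendsto_zero_of_cocycle {φ : DiffHalfLine} (hφ : ∀ x : ℝ≥0, 0 < x → x < φ.1 x)
    {a g h : ℝ → ℂ} (ha : ContDiffOn ℝ ∞ a (Ici 0)) (ha0 : 1 < ‖a 0‖)
    (hg : ContDiffOn ℝ ∞ g (Ioi 0)) (hh : Tendsto h (𝓝[>] 0) (𝓝 0))
    (heq : ∀ x, 0 < x → g (DiffHalfLine.toReal φ x) = a x * g x + h x) :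
    Tendsto g (𝓝[>] 0) (𝓝 0) := by
  obtain ⟨ρ, hρ, hρa⟩ := exists_between ha0
  have hρ0 : 0 < ρ := zero_lt_one.trans hρ
  have hcoe : Tendsto (fun x : ℝ≥0 => (x : ℝ)) (𝓝[>] 0) (𝓝[>] 0) := by
    refine tendsto_nhdsWithin_iff.2 ⟨(NNReal.continuous_coe.tendsto 0).mono_left
      nhdsWithin_le_nhds, ?_⟩
    filter_upwards [self_mem_nhdsWithin] with x hx using NNReal.coe_pos.2 hx
  have ha1 : ∀ᶠ x in 𝓝[>] (0 : ℝ), ρ < ‖a x‖ :=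
    ((ha.continuousOn 0 self_mem_Ici).mono Ioi_subset_Ici_self).norm.eventually_const_lt hρa
  have key := tendsto_zero_of_le_mul_comp hφ (G := fun x : ℝ≥0 => ‖g x‖) (θ := ρ⁻¹)
    (fun x => norm_nonneg _) ?_ (inv_pos.2 hρ0) (inv_lt_one_of_one_lt₀ hρ) ?_
  · have hto : Tendsto Real.toNNReal (𝓝[>] 0) (𝓝[>] 0) := by
      refine tendsto_nhdsWithin_iff.2 ⟨?_, ?_⟩
      · simpa using (continuous_real_toNNReal.tendsto 0).mono_left nhdsWithin_le_nhds
      · filter_upwards [self_mem_nhdsWithin] with x hx using Real.toNNReal_pos.2 hx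
    refine tendsto_zero_iff_norm_tendsto_zero.2 ((key.comp hto).congr' ?_)
    filter_upwards [self_mem_nhdsWithin] with x hx
    simp only [Function.comp_apply, Real.coe_toNNReal x (le_of_lt hx)]
  · exact (hg.continuousOn.comp NNReal.continuous_coe.continuousOn
      fun x hx => NNReal.coe_pos.2 hx).norm
  · intro ε hε
    have hh1 : ∀ᶠ x in 𝓝[>] (0 : ℝ), ‖h x‖ < ε := by
      simpa using (tendsto_zero_iff_norm_tendsto_zero.1 hh).eventually_lt_const hε
    filter_upwards [hcoe.eventually ha1, hcoe.eventually hh1, self_mem_nhdsWithin]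
      with x h1 h2 h3
    have e := heq x (NNReal.coe_pos.2 h3)
    rw [DiffHalfLine.toReal_coe] at e
    rw [le_inv_mul_iff₀ hρ0]
    have e' : a x * g x = g (φ.1 x) - h x := by rw [e]; ring
    calc ρ * ‖g x‖ ≤ ‖a x‖ * ‖g x‖ := by gcongr
      _ = ‖g (φ.1 x) - h x‖ := by rw [← norm_mul, e']
      _ ≤ ‖g (φ.1 x)‖ + ‖h x‖ := norm_sub_le _ _
      _ ≤ ‖g (φ.1 x)‖ + ε := by gcongr

/-- Solutions of a twisted cohomological equation over `φ` with expanding multiplier are flat at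
`0`. -/
theorem flatAtZero_of_cocycle {φ : DiffHalfLine} (hφ : ∀ x : ℝ≥0, 0 < x → x < φ.1 x)
    (hflat : InfinitelyTangentToId φ) {k : ℕ} : ∀ {a g h : ℝ → ℂ}, ContDiffOn ℝ ∞ a (Ici 0) →
    1 < ‖a 0‖ → ContDiffOn ℝ ∞ g (Ioi 0) → ContDiffOn ℝ ∞ h (Ioi 0) → FlatAtZero k h →
    (∀ x, 0 < x → g (DiffHalfLine.toReal φ x) = a x * g x + h x) → FlatAtZero k g := by
  induction k with
  | zero => exact fun ha ha0 hg _ hh heq => tendsto_zero_of_cocycle hφ ha ha0 hg hh heq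
  | succ k ih =>
    intro a g h ha ha0 hg hh hf heq
    refine ⟨tendsto_zero_of_cocycle hφ ha ha0 hg hf.1 heq, ?_⟩
    have hψ := DiffHalfLine.contDiffOn_toReal φ
    set d : ℝ → ℂ := fun x => ((derivWithin (DiffHalfLine.toReal φ) (Ici 0) x : ℝ) : ℂ) with hd
    have hds : ContDiffOn ℝ ∞ d (Ici 0) := Complex.ofRealCLM.contDiff.comp_contDiffOn
      hψ.derivWithin_Ici
    have hd0 : ∀ x ∈ Ici (0 : ℝ), d x ≠ 0 := fun x hx =>
      Complex.ofReal_ne_zero.2 (DiffHalfLine.derivWithin_ne_zero φ hx)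
    have hi : ContDiffOn ℝ ∞ (fun x => (d x)⁻¹) (Ici 0) := hds.inv hd0
    have hm1 : ContDiffOn ℝ ∞ (fun x => derivWithin a (Ici 0) x * (d x)⁻¹) (Ici 0) :=
      ha.derivWithin_Ici.mul hi
    -- Differentiating the equation and dividing by `d = φ'` gives `g' ∘ φ = (a / d) g' + (a' g +
    -- h') / d`. Since `d 0 = 1` the multiplier at `0` is unchanged, and the new inhomogeneous term
    -- is flat to order `k` because the induction hypothesis also applies to the original equation
    -- for `g`.
    refine ih (a := fun x => a x * (d x)⁻¹)
      (h := fun x => (derivWithin a (Ici 0) x * (d x)⁻¹) * g x + (d x)⁻¹ * deriv h x)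
      (ha.mul hi) ?_ hg.deriv_Ioi ?_ ?_ ?_
    · have : d 0 = 1 := by rw [hd]; simp [hflat.derivWithin_zero]
      simpa [this] using ha0
    · exact ((hm1.mono Ioi_subset_Ici_self).mul hg).add
        ((hi.mono Ioi_subset_Ici_self).mul hh.deriv_Ioi)
    · exact FlatAtZero.add ((hm1.mono Ioi_subset_Ici_self).mul hg)
        ((hi.mono Ioi_subset_Ici_self).mul hh.deriv_Ioi)
        (FlatAtZero.mul hm1 hg (ih ha ha0 hg hh hf.of_succ heq))
        (FlatAtZero.mul hi hh.deriv_Ioi hf.2)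
    · intro x hx
      have h1 : HasDerivAt (fun y => g (DiffHalfLine.toReal φ y))
          (derivWithin (DiffHalfLine.toReal φ) (Ici 0) x •
            deriv g (DiffHalfLine.toReal φ x)) x :=
        (hg.hasDerivAt_Ioi (DiffHalfLine.toReal_pos φ hx)).scomp x (hψ.hasDerivAt_of_pos hx)
      have h2 := ((ha.hasDerivAt_of_pos hx).mul (hg.hasDerivAt_Ioi hx)).add
        (hh.hasDerivAt_Ioi hx)
      have h3 := h2.congr_of_eventuallyEq (f₁ := fun y => g (DiffHalfLine.toReal φ y)) (by
        filter_upwards [Ioi_mem_nhds hx] with y hy using heq y hy)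
      have h4 := h1.unique h3
      rw [Complex.real_smul] at h4
      have hdx := hd0 x hx.le
      change d x * _ = _ at h4
      field_simp
      linear_combination h4

/-- The extension by zero of a function on `(0, ∞)`. -/
def extendZero (g : ℝ → ℂ) : ℝ → ℂ := (Ioi (0 : ℝ)).indicator g

/-- At `0` this is the principle that a continuous function whose derivative has a limit at an
endpoint has that limit as its one-sided derivative. -/
theorem hasDerivWithinAt_extendZero {g : ℝ → ℂ} (hg : ContDiffOn ℝ ∞ g (Ioi 0))
    (hf : FlatAtZero 1 g) {x : ℝ} (hx : 0 ≤ x) :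
    HasDerivWithinAt (extendZero g) (extendZero (deriv g) x) (Ici 0) x := by
  have he : ∀ y, 0 < y → extendZero g =ᶠ[𝓝 y] g := fun y hy => by
    filter_upwards [Ioi_mem_nhds hy] with z hz using indicator_of_mem hz g
  have hpos : ∀ y, 0 < y → HasDerivAt (extendZero g) (deriv g y) y := fun y hy =>
    (hg.hasDerivAt_Ioi hy).congr_of_eventuallyEq (he y hy)
  rcases hx.eq_or_lt with rfl | hx
  · have h0 : ∀ g' : ℝ → ℂ, extendZero g' 0 = 0 := fun g' => indicator_of_notMem (by simp) _
    rw [h0]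
    refine hasDerivWithinAt_Ici_of_tendsto_deriv (s := Ioi 0)
      (fun y hy => (hpos y hy).differentiableAt.differentiableWithinAt) ?_
      self_mem_nhdsWithin ?_
    · rw [ContinuousWithinAt, h0]
      refine hf.1.congr' ?_
      filter_upwards [self_mem_nhdsWithin] with y hy using (he y hy).eq_of_nhds.symm
    · refine Tendsto.congr' ?_ hf.2
      filter_upwards [self_mem_nhdsWithin] with y hy using (hpos y hy).deriv.symm
  · have : extendZero (deriv g) x = deriv g x := indicator_of_mem hx _
    rw [this]
    exact (hpos x hx).hasDerivWithinAt

theorem contDiffOn_extendZero {g : ℝ → ℂ} (hg : ContDiffOn ℝ ∞ g (Ioi 0))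
    (hf : ∀ k, FlatAtZero k g) : ContDiffOn ℝ ∞ (extendZero g) (Ici 0) := by
  refine contDiffOn_infty.2 fun n => ?_
  induction n generalizing g with
  | zero =>
    exact contDiffOn_zero.2 fun x hx => (hasDerivWithinAt_extendZero hg (hf 1) hx).continuousWithinAt
  | succ n ih =>
    push_cast
    refine (contDiffOn_succ_iff_derivWithin (uniqueDiffOn_Ici 0)).2
      ⟨fun x hx => (hasDerivWithinAt_extendZero hg (hf 1) hx).differentiableWithinAt,
        fun h => ?_, ?_⟩
    · exact absurd h WithTop.coe_ne_top
    · refine (ih hg.deriv_Ioi fun k => (hf (k + 1)).2).congr fun x hx => ?_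
      exact (hasDerivWithinAt_extendZero hg (hf 1) hx).derivWithin (uniqueDiffOn_Ici 0 x hx)

theorem flatAtZero_zero (k : ℕ) : FlatAtZero k fun _ => 0 := by
  induction k with
  | zero => exact tendsto_const_nhds
  | succ k ih => exact ⟨tendsto_const_nhds, ih.congr fun x _ => deriv_const x 0⟩

/-- For `|ν| > 1`, a smooth solution on `(0, ∞)` of `β ∘ φ = ν β` extends uniquely to `[0, ∞)`. -/
theorem existsUnique_solutionSpace_extension {φ : DiffHalfLine}
    (hφ : ∀ x : ℝ≥0, 0 < x → x < φ.1 x) (hflat : InfinitelyTangentToId φ) {ν : ℂ} (hν : 1 < ‖ν‖)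
    {β : ℝ → ℂ} (hβ : ContDiffOn ℝ ∞ β (Ioi 0))
    (heq : ∀ x : ℝ≥0, 0 < x → β (φ.1 x) = ν * β x) :
    ∃! b : solutionSpace φ ν, ∀ x : ℝ≥0, 0 < x → b.1 x = β x := by
  -- The cocycle equation with constant multiplier `ν` and no inhomogeneous term.
  have hflatβ : ∀ k, FlatAtZero k β := fun k =>
    flatAtZero_of_cocycle hφ hflat (a := fun _ => ν) (h := fun _ => 0) contDiffOn_const hν hβ
      contDiffOn_const (flatAtZero_zero k) fun x hx => by
        rw [add_zero, DiffHalfLine.toReal, heq _ (Real.toNNReal_pos.2 hx),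
          Real.coe_toNNReal x hx.le]
  have hv : ∀ x : ℝ≥0, 0 < x → extendZero β x = β x := fun x hx =>
    indicator_of_mem (NNReal.coe_pos.2 hx) _
  have hv0 : extendZero β ((0 : ℝ≥0) : ℝ) = 0 := indicator_of_notMem (by simp) _
  have hν1 : ν ≠ 1 := fun h1 => by simp [h1] at hν
  refine ⟨⟨fun x => extendZero β x, ?_, fun x => ?_⟩, hv, fun b hb => ?_⟩
  · refine (contDiffOn_extendZero hβ hflatβ).congr fun x hx => ?_
    simp only [Real.coe_toNNReal x hx]
  · rcases eq_or_ne x 0 with rfl | hx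
    · simp only [DiffHalfLine.apply_zero, hv0, mul_zero]
    · have hx := pos_iff_ne_zero.2 hx
      simp only [hv _ hx, hv _ (DiffHalfLine.pos_of_pos φ hx), heq x hx]
  · refine Subtype.ext (funext fun x => ?_)
    rcases eq_or_ne x 0 with rfl | hx
    · exact (solutionSpace.apply_zero hν1 b).trans hv0.symm
    · have hx := pos_iff_ne_zero.2 hx
      exact (hb x hx).trans (hv x hx).symm

end Extend
end

theorem theorem3p10 (lam mu : ℂˣ) (hmu : 1 < ‖(mu : ℂ)‖) (hlam : ‖(mu : ℂ)‖ ≤ ‖(lam : ℂ)‖)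
    (hne : lam ≠ mu) (φ : DiffHalfLine) (hφ : ∀ x : ℝ≥0, 0 < x → x < φ.1 x)
    (hflat : InfinitelyTangentToId φ) :
    -- for `|ν| > 1` every smooth solution on `(0, ∞)` extends uniquely to an element of `𝒵_{φ,ν}`
    (∀ ν : ℂ, 1 < ‖ν‖ → ∀ β : ℝ → ℂ, ContDiffOn ℝ ∞ β (Set.Ioi 0) →
      (∀ x : ℝ≥0, 0 < x → β (φ.1 x) = ν * β x) →
      ∃! b : solutionSpace φ ν, ∀ x : ℝ≥0, 0 < x → b.1 x = β x) ∧
    -- every element of `Aut(R, H)` has a unique lift that is the identity on the boundary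
    (∀ f : autReebRel lam mu φ, ∃! g : reebCover → reebCover, IsRelLift lam mu φ (⇑f.1) g) ∧
    -- the projection onto `Z_φ`, its kernel being `𝒦`
    ∃ P : autReebRel lam mu φ →* diffCentralizer φ,
      Function.Surjective P ∧
      (∀ f : autReebRel lam mu φ, ∀ g : reebCover → reebCover, IsRelLift lam mu φ (⇑f.1) g →
        ∀ q, height (g q) = (P f).1.1 (height q)) ∧
      -- case 1
      (∀ p : ℕ, 2 ≤ p → (lam : ℂ) = (mu : ℂ) ^ p →
        ∃ S : GroupExtension
            (Multiplicative ((j : Fin p) → solutionSpace φ ((mu : ℂ) ^ (p - (j : ℕ)))))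
            P.ker (Multiplicative (solutionSpace φ (mu : ℂ))),
          (∀ β : (j : Fin p) → solutionSpace φ ((mu : ℂ) ^ (p - (j : ℕ))),
            ∀ g : reebCover → reebCover,
            IsRelLift lam mu φ (⇑(S.inl (Multiplicative.ofAdd β)).1.1) g →
            ∀ q, (g q).1 =
              (q.1.1 + ∑ j, (β j).1 (height q) * q.1.2.1 ^ (j : ℕ), q.1.2.1, q.1.2.2)) ∧
          (∀ f : P.ker, ∀ g : reebCover → reebCover, IsRelLift lam mu φ (⇑f.1.1) g →
            ∀ q, (g q).1.2.1 = q.1.2.1 + (S.rightHom f).toAdd.1 (height q))) ∧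
      -- case 2
      ((∀ m : ℕ, 1 ≤ m → (lam : ℂ) ≠ (mu : ℂ) ^ m) →
        ∀ p : ℕ, p = ⌊Real.log ‖(lam : ℂ)‖ / Real.log ‖(mu : ℂ)‖⌋₊ →
        ∃ S : GroupExtension
            (Multiplicative
              ((j : Fin (p + 1)) → solutionSpace φ ((lam : ℂ) * ((mu : ℂ) ^ (j : ℕ))⁻¹)))
            P.ker (Multiplicative (solutionSpace φ (mu : ℂ))),
          (∀ β : (j : Fin (p + 1)) → solutionSpace φ ((lam : ℂ) * ((mu : ℂ) ^ (j : ℕ))⁻¹),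
            ∀ g : reebCover → reebCover,
            IsRelLift lam mu φ (⇑(S.inl (Multiplicative.ofAdd β)).1.1) g →
            ∀ q, (g q).1 =
              (q.1.1 + ∑ j, (β j).1 (height q) * q.1.2.1 ^ (j : ℕ), q.1.2.1, q.1.2.2)) ∧
          (∀ f : P.ker, ∀ g : reebCover → reebCover, IsRelLift lam mu φ (⇑f.1.1) g →
            ∀ q, (g q).1.2.1 = q.1.2.1 + (S.rightHom f).toAdd.1 (height q))) := by
  have h : IsExpanding lam mu φ := ⟨hmu, hlam, hφ⟩
  refine ⟨fun ν hν β hβ heq => existsUnique_solutionSpace_extension hφ hflat hν hβ heq,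
    fun f => ⟨relLift h f, isRelLift_relLift h f, fun g hg => eq_relLift h hg⟩,
    heightHom h, heightHom_surjective h, fun f g hg q => ?_, fun p hp hlm => ?_,
    fun hlm p hp => ?_⟩
  · rw [eq_relLift h hg]
    exact height_relLift_eq_heightHom h f q
  -- Resonant case: `|λ| = |μ| ^ p`, so `k = p` is admissible with equality. The multipliers `μ ^ (p
  -- - j)` with `j < p` have modulus greater than one.
  · refine exists_groupExtension h (fun j => ?_) (fun j hj => ?_) ?_
    · rw [← pow_add, Nat.sub_add_cancel j.2.le, hlm]
    · have := one_lt_pow₀ hmu (Nat.sub_ne_zero_of_lt j.2)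
      rw [← norm_pow, hj, norm_one] at this
      exact lt_irrefl _ this
    · rw [hlm, norm_pow]
  -- Non-resonant case: `|λ| < |μ| ^ (p + 1)` by the choice of `p`, so `k = p + 1`. The last
  -- multiplier may have modulus one, but equality with `1` would mean `λ = μ ^ j`.
  · refine exists_groupExtension h (fun j => ?_) (fun j hj => ?_) ?_
    · rw [inv_mul_cancel_right₀ (pow_ne_zero _ mu.ne_zero)]
    · have hl := (mul_inv_eq_one₀ (pow_ne_zero _ mu.ne_zero)).1 hj
      rcases Nat.eq_zero_or_pos (j : ℕ) with h0 | h0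
      · have := h.one_lt_lam
        rw [hl, h0, pow_zero, norm_one] at this
        exact lt_irrefl _ this
      · exact hlm _ h0 hl
    · have hlog := Real.log_pos hmu
      have h1 : Real.log ‖(lam : ℂ)‖ / Real.log ‖(mu : ℂ)‖ < p + 1 := by
        rw [hp]
        exact Nat.lt_floor_add_one _
      rw [div_lt_iff₀ hlog, ← Nat.cast_add_one, ← Real.log_pow] at h1
      exact ((Real.log_lt_log_iff (zero_lt_one.trans h.one_lt_lam)
        (pow_pos (zero_lt_one.trans hmu) _)).1 h1).le
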